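/- **Theorem (Uniqueness of solutions).** Let $h,c,k>0$ and let $B_\nu(T)=\frac{2h\nu^3}{c^2}\frac{1}{e^{h\nu/(kT)}-1}$ ($\nu>0$, $T\ge 0$, $B_\nu(0)=0$) be the Planck distribution. Let $\Omega\subset\mathbb R^3$ be a bounded convex domain with $C^1$ boundary and outward unit normal $n_x$ at $x\in\partial\Omega$. Let the absorption coefficient $\kappa_\nu(x)$ be measurable and positive for $\nu>0$, $x\in\Omega$. Let $T:\Omega\to[0,\infty)$ (the local temperature, defined up to null sets) and $I_\nu(x,n)$ (the radiation intensity), $I\in L^1((0,\infty)\times\Omega\times\mathbb S^2)$, solve the stationary radiative transfer equation without scattering $$n\cdot\nabla_x I_\nu(x,n)=\kappa_\nu(x)\,\bigl(B_\nu(T(x))-I_\nu(x,n)\bigr),\qquad x\in\Omega,\ n\in\mathbb S^2,\ \nu>0,$$ with the incoming boundary condition $$I_\nu(x,n)=g_\nu(x,n),\qquad x\in\partial\Omega,\ n\cdot n_x<0,$$ and suppose that the flux of radiation energy $\mathcal F(x)=\int_0^\infty d\nu\int_{\mathbb S^2}n\,I_\nu(x,n)\,dn$ satisfies $\nabla_x\cdot\mathcal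 F=0$ in $\Omega$ in the sense of distributions. Here the transfer equation and the boundary condition are understood along rays: for almost every $(\nu,x,n)\in(0,\infty)\times\Omega\times\mathbb S^2$, the function $t\mapsto I_\nu(x+tn,n)$ is locally absolutely continuous on $\{t: x+tn\in\Omega\}$, satisfies $\frac{d}{dt}I_\nu(x+tn,n)=\kappa_\nu(x+tn)\bigl(B_\nu(T(x+tn))-I_\nu(x+tn,n)\bigr)$ for almost every such $t$, and tends to $g_\nu(y,n)$ at the point $y\in\partial\Omega$ at which the ray enters $\Omega$. Suppose that the incoming radiation is at thermal equilibrium at a constant temperature $T_0>0$, that is, $g_\nu(x,n)=B_\nu(T_0)$ for all $\nu>0$, $x\in\partial\Omega$ and $n\in\mathbb S^2$ with $n\cdot n_x<0$. Suppose moreover that one of the following holds: 1. $\kappa_\nu(x)\le C$ for all $\nu>0$, $x\in\Omega$, with some constant $C$ (for example, $\kappa$ is a positive constant), and $T\in L^4(\Omega)$; or 2. $\kappa_\nu(x)\le\alpha_\nu$ for all $\nu>0$, $x\in\Omega$, with some $\alpha$ such that $\int_0^\infty\alpha_\nu\,d\nu<\infty$ (for example, $\kappa_\nu=\alpha_\nu>0$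 depends on $\nu$ only and is integrable), and $T\in L^\infty(\Omega)$. Then $T$ is constant and equal to the temperature of the incoming radiation: $T(x)=T_0$ for almost every $x\in\Omega$. -/

import Mathlib

open MeasureTheory Set Filter
open scoped Topology ContDiff ENNReal

namespace Radiative

/-- Physical space. -/
abbrev Space : Type := EuclideanSpace ℝ (Fin 3)

/-- The unit sphere of directions. -/
abbrev Direction : Type := Metric.sphere (0 : Space) 1

/-- The surface measure on the unit sphere (of total mass `4π`). -/
noncomputable def dirMeasure : Measure Direction :=
  (volume : Measure Space).toSphere

/-- The Planck distribution `B_ν(T) = (2hν³/c²) / (exp (hν/(kT)) - 1)`. It is used for `T ≥ 0`;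
at `T = 0` the formula evaluates to `0`, which is the limit as `T → 0+`. -/
noncomputable def planck (h c k ν T : ℝ) : ℝ :=
  2 * h * ν ^ 3 / c ^ 2 * (1 / (Real.exp (h * ν / (k * T)) - 1))

/-- `ρ` is a `C¹` defining function of `Ω` on the open neighbourhood `U` of `p`:
`Ω ∩ U = {ρ < 0} ∩ U`, and the gradient of `ρ` does not vanish at `p`. -/
structure IsLocalDefiningFunction (Ω : Set Space) (p : Space) (U : Set Space)
    (ρ : Space → ℝ) : Prop where
  isOpen : IsOpen U
  mem : p ∈ U
  contDiffOn : ContDiffOn ℝ 1 ρ U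
  gradient_ne_zero : gradient ρ p ≠ 0
  mem_iff : ∀ x ∈ U, x ∈ Ω ↔ ρ x < 0

/-- The boundary of `Ω` is of class `C¹`, with `Ω` locally on one side of it. -/
def HasC1Boundary (Ω : Set Space) : Prop :=
  ∀ p ∈ frontier Ω, ∃ U ρ, IsLocalDefiningFunction Ω p U ρ

/-- `v` is the outward unit normal vector of `Ω` at the boundary point `p`. -/
def IsOutwardUnitNormal (Ω : Set Space) (p v : Space) : Prop :=
  p ∈ frontier Ω ∧
    ∃ U ρ, IsLocalDefiningFunction Ω p U ρ ∧ v = ‖gradient ρ p‖⁻¹ • gradient ρ p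

/-- `(y, n)` is an incoming boundary pair: `y ∈ ∂Ω` and `n · n_y < 0`. -/
def IsIncoming (Ω : Set Space) (y : Space) (n : Direction) : Prop :=
  ∃ v, IsOutwardUnitNormal Ω y v ∧ inner ℝ (n : Space) v < 0

/-- The measure `dν dx dn` on `(0, ∞) × Ω × 𝕊²`. -/
noncomputable def phaseMeasure (Ω : Set Space) : Measure (ℝ × Space × Direction) :=
  ((volume : Measure ℝ).restrict (Ioi 0)).prod
    (((volume : Measure Space).restrict Ω).prod dirMeasure)

/-- The flux of radiation energy `F(x) = ∫_0^∞ dν ∫_{𝕊²} n I_ν(x, n) dn`. -/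
noncomputable def flux (I : ℝ → Space → Direction → ℝ) (x : Space) : Space :=
  ∫ ν in Ioi (0 : ℝ), ∫ n, I ν x n • (n : Space) ∂dirMeasure

/-- `∇ · F = 0` in `Ω`, in the sense of distributions: `∫_Ω F · ∇φ dx = 0` for every smooth `φ`
compactly supported in `Ω`. -/
def DivergenceFree (Ω : Set Space) (F : Space → Space) : Prop :=
  ∀ φ : Space → ℝ, ContDiff ℝ ∞ φ → HasCompactSupport φ → tsupport φ ⊆ Ω →
    ∫ x in Ω, inner ℝ (F x) (gradient φ x) = 0

/-- On the chord `{x + t n} ∩ Ω`, the intensity of frequency `ν` in the direction `n` is locally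
absolutely continuous and satisfies `n · ∇ I_ν = κ_ν (B_ν(T) - I_ν)` almost everywhere. -/
def TransportOnChord (h c k : ℝ) (Ω : Set Space) (κ : ℝ → Space → ℝ) (T : Space → ℝ)
    (I : ℝ → Space → Direction → ℝ) (ν : ℝ) (x : Space) (n : Direction) : Prop :=
  (∀ a b : ℝ, a ≤ b → x + a • (n : Space) ∈ Ω → x + b • (n : Space) ∈ Ω →
    AbsolutelyContinuousOnInterval (fun t : ℝ => I ν (x + t • (n : Space)) n) a b) ∧
  ∀ᵐ t : ℝ, x + t • (n : Space) ∈ Ω →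
    HasDerivAt (fun s : ℝ => I ν (x + s • (n : Space)) n)
      (κ ν (x + t • (n : Space)) *
        (planck h c k ν (T (x + t • (n : Space))) - I ν (x + t • (n : Space)) n)) t

/-- The incoming boundary condition for the ray that reaches `x` in the direction `n`: at the
boundary point `y = x - t n` with `n · n_y < 0`, the intensity attains the value `g_ν(y, n)` as a
limit from inside along the ray. -/
def IncomingOnChord (Ω : Set Space) (g I : ℝ → Space → Direction → ℝ)
    (ν : ℝ) (x : Space) (n : Direction) : Prop :=
  ∀ t : ℝ, 0 < t → IsIncoming Ω (x - t • (n : Space)) n →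
    Tendsto (fun s : ℝ => I ν (x - t • (n : Space) + s • (n : Space)) n) (𝓝[>] 0)
      (𝓝 (g ν (x - t • (n : Space)) n))

/-- `(T, I)` solves the stationary radiative transfer equation without scattering, with absorption
coefficient `κ`, coupled with the divergence-free-flux condition and with the incoming boundary
profile `g`. `T` and `I` are functions up to null sets, and `I` is represented so as to be absolutely
continuous along almost every ray. -/
structure IsSolution (h c k : ℝ) (Ω : Set Space) (κ : ℝ → Space → ℝ)
    (g : ℝ → Space → Direction → ℝ) (T : Space → ℝ) (I : ℝ → Space → Direction → ℝ) : Prop where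
  /-- Temperatures are absolute. -/
  temp_nonneg : ∀ᵐ x ∂((volume : Measure Space).restrict Ω), 0 ≤ T x
  /-- The energy flux is well defined. -/
  integrable : Integrable (fun p : ℝ × Space × Direction => I p.1 p.2.1 p.2.2) (phaseMeasure Ω)
  transport : ∀ᵐ p ∂(phaseMeasure Ω), TransportOnChord h c k Ω κ T I p.1 p.2.1 p.2.2
  incoming : ∀ᵐ p ∂(phaseMeasure Ω), IncomingOnChord Ω g I p.1 p.2.1 p.2.2
  divergenceFree : DivergenceFree Ω (flux I)

end Radiative

/-! The proof compares emission with absorption. Put `J = I - B_ν(T₀)` and `β = B_ν(T) - B_ν(T₀)`.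
Since `B_ν(T₀)` does not depend on position, `J` solves the same transport equation with source `β`
and enters `Ω` with value `0`. Along a ray `|J|' ≤ κ|β| - κ|J|`, so no more is absorbed than
emitted: `∫ κ|J| ≤ ∫ κ|β|`. Some radiation also leaves through the far end of the chord, and since
`κ` is bounded on each ray a definite fraction is lost: the inequality holds with a factor `1 + δ`
on the left (`chord_gap`). The number `δ` may depend on the ray.

The opposite inequality is local in `x`. Zero divergence of the flux gives `∫∫ κ(β - J) dν dn = 0`
for almost every `x` (`ae_energy_balance`). The Planck distribution increases with temperature, so
at a fixed `x` the sign of `β` is the same for all frequencies, and `∫∫ κ|β| = |∫∫ κβ| = |∫∫ κJ| ≤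
∫∫ κ|J|`.

The two inequalities are integrated over the same phase space, one by rays and one by points. The
passage from rays to phase space is a disintegration along the free transport flow
(`IsTransientFlow.setLIntegral_eq`). If the total emission is finite, which is what each of the
alternative hypotheses on `κ` and `T` provides, the inequalities are equalities. The gap on each ray
then forces `κ|β| = 0` almost everywhere (`IsTransientFlow.setLIntegral_eq_zero_of_gap`), and strict
monotonicity of the Planck distribution gives `T = T₀`. -/

namespace Radiative

/-! ### Calculus on a single chord -/

/-- Integration by parts on an interval against a test function supported inside it. -/
theorem integral_chord_eq_zero {a b a' b' : ℝ} (ha : a < a') (hab' : a' ≤ b') (hb : b' < b)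
    {u r φ : ℝ → ℝ} (hu : AbsolutelyContinuousOnInterval u a' b')
    (hd : ∀ᵐ t : ℝ, t ∈ Ioo a b → HasDerivAt u (r t) t)
    (hφ : ContDiff ℝ 1 φ) (hs : ∀ t, t ∉ Ioo a' b' → φ t = 0) :
    IntegrableOn (fun t => φ t * r t + u t * deriv φ t) (Ioo a b) ∧
      ∫ t in Ioo a b, (φ t * r t + u t * deriv φ t) = 0 := by
  have hsub : Icc a' b' ⊆ Ioo a b := fun t ht => ⟨ha.trans_le ht.1, ht.2.trans_lt hb⟩
  have hAC : AbsolutelyContinuousOnInterval (fun t => u t * φ t) a' b' :=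
    hu.mul hφ.contDiffOn.absolutelyContinuousOnInterval
  have hzero : ∀ t, t ∉ Icc a' b' → φ t * r t + u t * deriv φ t = 0 := by
    intro t ht
    have h1 : φ =ᶠ[𝓝 t] fun _ => 0 := by
      filter_upwards [isClosed_Icc.isOpen_compl.mem_nhds ht] with s hs'
      exact hs s fun h => hs' (Ioo_subset_Icc_self h)
    rw [h1.deriv_eq, h1.self_of_nhds]
    simp
  have hderiv : ∀ᵐ t ∂(volume.restrict (Icc a' b')),
      deriv (fun t => u t * φ t) t = φ t * r t + u t * deriv φ t := by
    rw [ae_restrict_iff' measurableSet_Icc]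
    filter_upwards [hd] with t ht hmem
    have h1 := (ht (hsub hmem)).mul
      ((hφ.differentiable (by norm_num)).differentiableAt (x := t)).hasDerivAt
    rw [show (fun t => u t * φ t) = u * φ from rfl, h1.deriv]
    ring
  have hint : IntegrableOn (fun t => φ t * r t + u t * deriv φ t) (Icc a' b') := by
    have h1 := hAC.intervalIntegrable_deriv
    rw [intervalIntegrable_iff_integrableOn_Icc_of_le hab'] at h1
    exact h1.congr hderiv
  refine ⟨hint.of_forall_sdiff_eq_zero measurableSet_Ioo fun t ht => hzero t ht.2, ?_⟩
  rw [setIntegral_eq_of_subset_of_forall_sdiff_eq_zero measurableSet_Ioo hsub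
    fun t ht => hzero t ht.2, ← integral_congr_ae hderiv, integral_Icc_eq_integral_Ioc,
    ← intervalIntegral.integral_of_le hab', hAC.integral_deriv_eq_sub, hs a' (by simp),
    hs b' (by simp)]
  simp

/-- A non-negative function has zero `deriv` where it vanishes. -/
theorem deriv_eq_zero_of_nonneg {f : ℝ → ℝ} {t : ℝ} (hf : ∀ᶠ s in 𝓝 t, 0 ≤ f s) (h0 : f t = 0) :
    deriv f t = 0 :=
  IsLocalMin.deriv_eq_zero (by
    filter_upwards [hf] with s hs
    rwa [h0])

/-- The damping inequality for the transport equation on a chord: the absorbed intensity is smaller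
than the emitted one by a definite factor. -/
theorem chord_gap {a b C : ℝ} (hab : a < b) {κ β J : ℝ → ℝ}
    (hκm : Measurable κ) (hκ0 : ∀ t ∈ Ioo a b, 0 < κ t) (hκC : ∀ t ∈ Ioo a b, κ t ≤ C)
    (hAC : ∀ a' b', a < a' → a' ≤ b' → b' < b → AbsolutelyContinuousOnInterval J a' b')
    (hd : ∀ᵐ t : ℝ, t ∈ Ioo a b → HasDerivAt J (κ t * (β t - J t)) t)
    (hlim : Tendsto J (𝓝[>] a) (𝓝 0)) :
    ∃ δ : ℝ, 0 < δ ∧ ENNReal.ofReal (1 + δ) * ∫⁻ t in Ioo a b, ENNReal.ofReal (κ t * |J t|) ≤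
      ∫⁻ t in Ioo a b, ENNReal.ofReal (κ t * |β t|) := by
  have hC : 0 < C := by
    have hm : (a + b) / 2 ∈ Ioo a b := ⟨by linarith, by linarith⟩
    exact (hκ0 _ hm).trans_le (hκC _ hm)
  -- With this value the weight `ψ` below decreases from `1` at `a` to `δ > 0` at `b`.
  set δ : ℝ := Real.exp (-(C * (b - a))) with hδ
  have hδ0 : 0 < δ := Real.exp_pos _
  refine ⟨δ, hδ0, ?_⟩
  -- The weight solves `ψ' = -C(1 + δ - ψ)`. As `κ ≤ C`, this gives `ψ' ≤ -κ(1 + δ - ψ)`, and hence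
  -- `(ψ|J|)' ≤ κ|β| - (1 + δ)κ|J|`.
  set ψ : ℝ → ℝ := fun t => 1 + δ - δ * Real.exp (C * (t - a)) with hψ
  have hψd : ∀ t, HasDerivAt ψ (-(δ * (Real.exp (C * (t - a)) * C))) t := by
    intro t
    have h1 : HasDerivAt (fun t => C * (t - a)) C t := by
      simpa using ((hasDerivAt_id t).sub_const a).const_mul C
    simpa [hψ] using (h1.exp.const_mul δ).const_sub (1 + δ)
  have hψc : ContDiff ℝ 1 ψ := by
    rw [hψ]; fun_prop
  have hψ1 : ∀ t, a ≤ t → ψ t ≤ 1 := by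
    intro t ht
    have : 1 ≤ Real.exp (C * (t - a)) := Real.one_le_exp (mul_nonneg hC.le (by linarith))
    simp only [hψ]; nlinarith
  have hψ0 : ∀ t, t ≤ b → 0 < ψ t := by
    intro t ht
    have : δ * Real.exp (C * (t - a)) ≤ 1 := by
      rw [hδ, ← Real.exp_add, Real.exp_le_one_iff]
      nlinarith
    simp only [hψ]; linarith
  have hJc : ContinuousOn J (Ioo a b) := by
    intro t ht
    obtain ⟨a', ha1, ha2⟩ := exists_between ht.1
    obtain ⟨b', hb1, hb2⟩ := exists_between ht.2
    have h1 := (hAC a' b' ha1 (ha2.trans hb1).le hb2).continuousOn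
    rw [uIcc_of_le (ha2.trans hb1).le] at h1
    exact (h1.continuousAt (Icc_mem_nhds ha2 hb1)).continuousWithinAt
  have hJm : AEMeasurable J (volume.restrict (Ioo a b)) := hJc.aemeasurable measurableSet_Ioo
  have hdr : ∀ᵐ t ∂(volume.restrict (Ioo a b)), HasDerivAt J (κ t * (β t - J t)) t :=
    (ae_restrict_iff' measurableSet_Ioo).2 hd
  -- No measurability of `β` is assumed; it is recovered from the equation as `κβ = J' + κJ`.
  have hqm : AEMeasurable (fun t => κ t * |β t|) (volume.restrict (Ioo a b)) := by
    have h1 : AEMeasurable (fun t => |deriv J t + κ t * J t|) (volume.restrict (Ioo a b)) :=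
      ((measurable_deriv J).aemeasurable.add (hκm.aemeasurable.mul hJm)).norm
    refine h1.congr ?_
    filter_upwards [hdr, ae_restrict_mem measurableSet_Ioo] with t ht hmem
    rw [ht.deriv, ← abs_of_pos (hκ0 t hmem), ← abs_mul, abs_of_pos (hκ0 t hmem)]
    congr 1; ring
  by_cases hfin : ∫⁻ t in Ioo a b, ENNReal.ofReal (κ t * |β t|) = ⊤
  · rw [hfin]; exact le_top
  have hqpos : ∀ᵐ t ∂(volume.restrict (Ioo a b)), 0 ≤ κ t * |β t| := by
    filter_upwards [ae_restrict_mem measurableSet_Ioo] with t hmem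
    exact mul_nonneg (hκ0 t hmem).le (abs_nonneg _)
  have hq : IntegrableOn (fun t => κ t * |β t|) (Ioo a b) :=
    (lintegral_ofReal_ne_top_iff_integrable hqm.aestronglyMeasurable hqpos).1 hfin
  -- Absolute continuity is available only on compact subintervals. The boundary term `|J a'|` is
  -- the price, and it vanishes as `a' → a`.
  have key : ∀ a' b', a < a' → a' < b' → b' < b →
      ENNReal.ofReal (1 + δ) * ∫⁻ t in Icc a' b', ENNReal.ofReal (κ t * |J t|) ≤
        ENNReal.ofReal |J a'| + ∫⁻ t in Ioo a b, ENNReal.ofReal (κ t * |β t|) := by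
    intro a' b' ha' hab' hb'
    have hsub : Icc a' b' ⊆ Ioo a b := fun t ht => ⟨ha'.trans_le ht.1, ht.2.trans_lt hb'⟩
    have hvAC : AbsolutelyContinuousOnInterval (fun t => |J t|) a' b' := by
      have h1 := hAC a' b' ha' hab'.le hb'
      unfold AbsolutelyContinuousOnInterval at h1 ⊢
      refine squeeze_zero (fun E => Finset.sum_nonneg fun i _ => dist_nonneg) (fun E => ?_) h1
      exact Finset.sum_le_sum fun i _ => abs_abs_sub_abs_le_abs_sub _ _
    have hfAC : AbsolutelyContinuousOnInterval (fun t => ψ t * |J t|) a' b' :=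
      hψc.contDiffOn.absolutelyContinuousOnInterval.mul hvAC
    have hvint : IntegrableOn (fun t => κ t * |J t|) (Icc a' b') := by
      obtain ⟨M, hM⟩ := hvAC.exists_bound
      rw [uIcc_of_le hab'.le] at hM
      refine Integrable.of_bound (C := C * M) ?_ ?_
      · exact ((hκm.aemeasurable.mul hJm.norm).mono_measure
          (Measure.restrict_mono hsub le_rfl)).aestronglyMeasurable
      · filter_upwards [ae_restrict_mem measurableSet_Icc] with t ht
        rw [norm_mul, Real.norm_of_nonneg (hκ0 t (hsub ht)).le]
        exact mul_le_mul (hκC t (hsub ht)) (hM t ht) (norm_nonneg _) hC.le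
    have hle : ∀ᵐ t ∂(volume.restrict (Icc a' b')),
        deriv (fun t => ψ t * |J t|) t ≤ κ t * |β t| - (1 + δ) * (κ t * |J t|) := by
      rw [ae_restrict_iff' measurableSet_Icc]
      filter_upwards [hd] with t ht hmem
      have hmem' := hsub hmem
      have hκt := hκ0 t hmem'
      have hψt0 := hψ0 t hmem'.2.le
      have hψt1 := hψ1 t hmem'.1.le
      have hD := ht hmem'
      -- At a zero of `J` the function `ψ|J|` has a local minimum, so `deriv` is `0` there, be it a
      -- true derivative or the default value.
      by_cases hJ0 : J t = 0
      · rw [deriv_eq_zero_of_nonneg _ (by simp [hJ0])]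
        · simp only [hJ0, abs_zero, mul_zero, sub_zero]
          positivity
        · filter_upwards [Iio_mem_nhds hmem'.2] with s hs
          exact mul_nonneg (hψ0 s (le_of_lt hs)).le (abs_nonneg _)
      · have habs : ∃ σ : ℝ, (σ = 1 ∨ σ = -1) ∧ σ * J t = |J t| ∧
            HasDerivAt (fun s => |J s|) (σ * (κ t * (β t - J t))) t := by
          rcases lt_or_gt_of_ne hJ0 with h | h
          · refine ⟨-1, Or.inr rfl, by rw [abs_of_neg h]; ring, ?_⟩
            refine (hD.const_mul (-1)).congr_of_eventuallyEq ?_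
            filter_upwards [hD.continuousAt.eventually_lt_const h] with s hs
            rw [abs_of_neg hs]; ring
          · refine ⟨1, Or.inl rfl, by rw [abs_of_pos h]; ring, ?_⟩
            refine (hD.const_mul 1).congr_of_eventuallyEq ?_
            filter_upwards [hD.continuousAt.eventually_const_lt h] with s hs
            rw [abs_of_pos hs]; ring
        obtain ⟨σ, hσ, hσJ, hσd⟩ := habs
        have hβ : σ * β t ≤ |β t| := by
          rcases hσ with rfl | rfl
          · simpa using le_abs_self (β t)
          · simpa using neg_le_abs (β t)
        have h1 := ((hψd t).mul hσd).deriv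
        rw [show (ψ * fun s => |J s|) = fun t => ψ t * |J t| from rfl] at h1
        rw [h1]
        have hv : 0 ≤ |J t| := abs_nonneg _
        have hκCt := hκC t hmem'
        have e1 : σ * (κ t * (β t - J t)) ≤ κ t * |β t| - κ t * |J t| := by
          rw [← hσJ]; nlinarith
        have e2 : ψ t * (σ * (κ t * (β t - J t))) ≤ κ t * |β t| - ψ t * (κ t * |J t|) := by
          have := mul_le_mul_of_nonneg_left e1 hψt0.le
          have : ψ t * (κ t * |β t|) ≤ 1 * (κ t * |β t|) :=
            mul_le_mul_of_nonneg_right hψt1 (by positivity)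
          linarith
        have e3 : δ * Real.exp (C * (t - a)) * (κ t * |J t|) ≤
            δ * (Real.exp (C * (t - a)) * C) * |J t| := by
          have : κ t * |J t| ≤ C * |J t| := mul_le_mul_of_nonneg_right hκCt hv
          have := mul_le_mul_of_nonneg_left this (show 0 ≤ δ * Real.exp (C * (t - a)) by positivity)
          linarith
        have e4 : ψ t * (κ t * |J t|) =
            (1 + δ) * (κ t * |J t|) - δ * Real.exp (C * (t - a)) * (κ t * |J t|) := by
          simp only [hψ]; ring
        linarith
    have hq' : IntegrableOn (fun t => κ t * |β t|) (Icc a' b') := hq.mono_set hsub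
    have h1 := hfAC.intervalIntegrable_deriv
    rw [intervalIntegrable_iff_integrableOn_Icc_of_le hab'.le] at h1
    have h2 := integral_mono_ae h1 (hq'.sub (hvint.const_mul (1 + δ))) hle
    rw [integral_Icc_eq_integral_Ioc, ← intervalIntegral.integral_of_le hab'.le,
      hfAC.integral_deriv_eq_sub] at h2
    rw [show (fun t => κ t * |β t|) - (fun t => (1 + δ) * (κ t * |J t|)) =
      fun t => κ t * |β t| - (1 + δ) * (κ t * |J t|) from rfl,
      integral_sub hq' (hvint.const_mul (1 + δ)), integral_const_mul] at h2
    have h3 : ∫ t in Icc a' b', κ t * |β t| ≤ ∫ t in Ioo a b, κ t * |β t| :=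
      setIntegral_mono_set hq hqpos hsub.eventuallyLE
    have h4 : 0 ≤ ψ b' * |J b'| := mul_nonneg (hψ0 b' hb'.le).le (abs_nonneg _)
    have h5 : ψ a' * |J a'| ≤ 1 * |J a'| :=
      mul_le_mul_of_nonneg_right (hψ1 a' ha'.le) (abs_nonneg _)
    have h6 : (1 + δ) * ∫ t in Icc a' b', κ t * |J t| ≤
        |J a'| + ∫ t in Ioo a b, κ t * |β t| := by linarith
    rw [← ofReal_integral_eq_lintegral_ofReal hq hqpos,
      ← ofReal_integral_eq_lintegral_ofReal hvint, ← ENNReal.ofReal_mul (by positivity),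
      ← ENNReal.ofReal_add (abs_nonneg _) (integral_nonneg_of_ae hqpos)]
    · exact ENNReal.ofReal_le_ofReal h6
    · filter_upwards [ae_restrict_mem measurableSet_Icc] with t ht
      exact mul_nonneg (hκ0 t (hsub ht)).le (abs_nonneg _)
  -- The shift by `3` keeps `a + ε n < b - ε n` already for `n = 0`.
  set ε : ℕ → ℝ := fun n => (b - a) / (n + 3) with hε
  have hε0 : Tendsto ε atTop (𝓝 0) :=
    Tendsto.div_atTop tendsto_const_nhds
      (tendsto_atTop_add_const_right _ _ tendsto_natCast_atTop_atTop)
  have hεpos : ∀ n, 0 < ε n := fun n => div_pos (by linarith) (by positivity)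
  have hεlt : ∀ n, a + ε n < b - ε n := by
    intro n
    have h1 : ε n * (n + 3) = b - a := div_mul_cancel₀ _ (by positivity)
    have h2 : 0 ≤ ε n * n := mul_nonneg (hεpos n).le (Nat.cast_nonneg n)
    nlinarith [hεpos n]
  have hta : Tendsto (fun n => a + ε n) atTop (𝓝 a) := by simpa using hε0.const_add a
  have htb : Tendsto (fun n => b - ε n) atTop (𝓝 b) := by simpa using hε0.const_sub b
  have hcov : AECover (volume.restrict (Ioo a b)) atTop fun n => Icc (a + ε n) (b - ε n) :=
    aecover_Ioo_of_Icc hta htb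
  have hL := hcov.lintegral_tendsto_of_countably_generated
    (f := fun t => ENNReal.ofReal (κ t * |J t|)) (hκm.aemeasurable.mul hJm.norm).ennreal_ofReal
  have hL' := ENNReal.Tendsto.const_mul (a := ENNReal.ofReal (1 + δ)) hL
    (Or.inr ENNReal.ofReal_ne_top)
  have hta' : Tendsto (fun n => a + ε n) atTop (𝓝[>] a) :=
    tendsto_nhdsWithin_iff.2 ⟨hta, Eventually.of_forall fun n => by simpa using hεpos n⟩
  have hR : Tendsto (fun n => ENNReal.ofReal |J (a + ε n)| +
      ∫⁻ t in Ioo a b, ENNReal.ofReal (κ t * |β t|)) atTop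
      (𝓝 (∫⁻ t in Ioo a b, ENNReal.ofReal (κ t * |β t|))) := by
    have h1 := ENNReal.tendsto_ofReal (hlim.comp hta').abs
    simp only [abs_zero, ENNReal.ofReal_zero] at h1
    simpa using h1.add_const (∫⁻ t in Ioo a b, ENNReal.ofReal (κ t * |β t|))
  refine le_of_tendsto_of_tendsto' hL' hR fun n => ?_
  rw [Measure.restrict_restrict measurableSet_Icc, inter_eq_left.2]
  · exact key _ _ (by linarith [hεpos n]) (hεlt n) (by linarith [hεpos n])
  · exact fun t ht => ⟨by linarith [hεpos n, ht.1], by linarith [hεpos n, ht.2]⟩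

/-! ### Disintegration along the orbits of a measure-preserving flow -/

/-- The set of times which a flow `Φ` spends in `D` when started from `p`. -/
def chordTimes {X : Type*} (Φ : ℝ → X → X) (D : Set X) (p : X) : Set ℝ := {t | Φ t p ∈ D}

/-- A measurable measure-preserving flow such that every orbit starting in `D` spends a positive
finite total time in `D`. -/
structure IsTransientFlow {X : Type*} [MeasurableSpace X] (μ : Measure X) (Φ : ℝ → X → X)
    (D : Set X) : Prop where
  measurable : Measurable fun q : ℝ × X => Φ q.1 q.2
  preserving : ∀ t, MeasurePreserving (Φ t) μ μ
  comp : ∀ s t p, Φ s (Φ t p) = Φ (s + t) p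
  zero : ∀ p, Φ 0 p = p
  measurableSet : MeasurableSet D
  time_ne_zero : ∀ p ∈ D, volume (chordTimes Φ D p) ≠ 0
  time_ne_top : ∀ p ∈ D, volume (chordTimes Φ D p) ≠ ⊤

namespace IsTransientFlow

theorem volume_chordTimes_eq {X : Type*} (Φ : ℝ → X → X) (D : Set X) (p : X) :
    volume (chordTimes Φ D p) = ∫⁻ t in chordTimes Φ D p, (fun _ => 1) (Φ t p) := by
  simp

variable {X : Type*} [MeasurableSpace X] {μ : Measure X} {Φ : ℝ → X → X} {D : Set X}

theorem measurable_orbit (h : IsTransientFlow μ Φ D) (p : X) : Measurable fun t => Φ t p :=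
  h.measurable.comp (measurable_id.prodMk measurable_const)

theorem measurableSet_chordTimes (h : IsTransientFlow μ Φ D) (p : X) :
    MeasurableSet (chordTimes Φ D p) :=
  h.measurable_orbit p h.measurableSet

theorem setLIntegral_chordTimes (h : IsTransientFlow μ Φ D) (F : X → ℝ≥0∞) (p : X) :
    ∫⁻ t in chordTimes Φ D p, F (Φ t p) = ∫⁻ t, D.indicator F (Φ t p) := by
  rw [← lintegral_indicator (h.measurableSet_chordTimes p)]
  rfl

theorem measurable_setLIntegral_chordTimes (h : IsTransientFlow μ Φ D) {F : X → ℝ≥0∞}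
    (hF : Measurable F) : Measurable fun p => ∫⁻ t in chordTimes Φ D p, F (Φ t p) := by
  simp_rw [h.setLIntegral_chordTimes]
  exact ((hF.indicator h.measurableSet).comp
    (h.measurable.comp measurable_swap)).lintegral_prod_right'

theorem measurable_volume_chordTimes (h : IsTransientFlow μ Φ D) :
    Measurable fun p => volume (chordTimes Φ D p) := by
  simp_rw [volume_chordTimes_eq Φ D]
  exact h.measurable_setLIntegral_chordTimes measurable_const

/-- Moving the starting point along the orbit only translates the set of times. Thus the weight `1 /
length` is constant on orbits. -/
theorem volume_chordTimes_flow (h : IsTransientFlow μ Φ D) (s : ℝ) (p : X) :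
    volume (chordTimes Φ D (Φ s p)) = volume (chordTimes Φ D p) := by
  have : chordTimes Φ D (Φ s p) = (fun t => t + s) ⁻¹' chordTimes Φ D p := by
    ext t; simp [chordTimes, h.comp]
  rw [this, measure_preimage_add_right]

theorem volume_chordTimes_neg (h : IsTransientFlow μ Φ D) (p : X) :
    ∫⁻ t, D.indicator (fun _ => (1 : ℝ≥0∞)) (Φ (-t) p) = volume (chordTimes Φ D p) := by
  rw [volume_chordTimes_eq Φ D, h.setLIntegral_chordTimes fun _ => 1]
  exact lintegral_neg_eq_self (μ := volume)
    (fun t => D.indicator (fun _ => (1 : ℝ≥0∞)) (Φ t p))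

/-- Disintegration along the orbits of a flow, for measurable functions. -/
theorem setLIntegral_eq_of_measurable [SFinite μ] (h : IsTransientFlow μ Φ D) {F : X → ℝ≥0∞}
    (hF : Measurable F) :
    ∫⁻ p in D, F p ∂μ =
      ∫⁻ p in D, (volume (chordTimes Φ D p))⁻¹ * (∫⁻ t in chordTimes Φ D p, F (Φ t p)) ∂μ := by
  set len : X → ℝ≥0∞ := fun p => volume (chordTimes Φ D p) with hlen
  have hlm : Measurable len := h.measurable_volume_chordTimes
  set G : X → ℝ≥0∞ := D.indicator F with hG
  have hGm : Measurable G := hF.indicator h.measurableSet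
  set χ : X → ℝ≥0∞ := D.indicator fun _ => 1 with hχ
  have hχm : Measurable χ := measurable_const.indicator h.measurableSet
  have hm2 : Measurable fun q : X × ℝ => Φ q.2 q.1 := h.measurable.comp measurable_swap
  have hmn : Measurable fun q : X × ℝ => Φ (-q.2) q.1 :=
    h.measurable.comp ((measurable_snd.neg).prodMk measurable_fst)
  -- Insert `len⁻¹ * len = 1`, write `len q` as the time which the backward orbit of `q` spends in
  -- `D`, exchange the integrals, substitute `q = Φ t p` by invariance of `μ`, and exchange back.
  -- The weight is unaffected by the substitution because `len` is constant on orbits.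
  calc ∫⁻ p in D, F p ∂μ = ∫⁻ q, (len q)⁻¹ * G q * len q ∂μ := by
        rw [← lintegral_indicator h.measurableSet]
        refine lintegral_congr fun q => ?_
        by_cases hq : q ∈ D
        · rw [mul_right_comm, ENNReal.inv_mul_cancel (h.time_ne_zero q hq) (h.time_ne_top q hq),
            one_mul]
        · simp [hG, hq]
    _ = ∫⁻ q, (∫⁻ t, (len q)⁻¹ * G q * χ (Φ (-t) q)) ∂μ := by
        refine lintegral_congr fun q => ?_
        have hm : Measurable fun t => χ (Φ (-t) q) :=
          hχm.comp ((h.measurable_orbit q).comp measurable_neg)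
        rw [lintegral_const_mul _ hm, h.volume_chordTimes_neg]
    _ = ∫⁻ t, ∫⁻ q, (len q)⁻¹ * G q * χ (Φ (-t) q) ∂μ := by
        refine lintegral_lintegral_swap (Measurable.aemeasurable ?_)
        exact ((hlm.inv.mul hGm).comp measurable_fst).mul (hχm.comp hmn)
    _ = ∫⁻ t, ∫⁻ p, χ p * ((len p)⁻¹ * G (Φ t p)) ∂μ := by
        refine lintegral_congr fun t => ?_
        have hmt : Measurable (Φ (-t)) := (h.preserving (-t)).measurable
        rw [← (h.preserving t).lintegral_comp (f := fun q => (len q)⁻¹ * G q * χ (Φ (-t) q))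
          ((hlm.inv.mul hGm).mul (hχm.comp hmt))]
        refine lintegral_congr fun p => ?_
        simp only [h.comp, neg_add_cancel, h.zero]
        rw [hlen]
        simp only [h.volume_chordTimes_flow]
        ring
    _ = ∫⁻ p, (∫⁻ t, χ p * ((len p)⁻¹ * G (Φ t p))) ∂μ := by
        refine (lintegral_lintegral_swap (Measurable.aemeasurable ?_)).symm
        exact (hχm.comp measurable_fst).mul ((hlm.inv.comp measurable_fst).mul (hGm.comp hm2))
    _ = _ := by
        rw [← lintegral_indicator h.measurableSet]
        refine lintegral_congr fun p => ?_
        have hGo : Measurable fun t => G (Φ t p) := hGm.comp (h.measurable_orbit p)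
        rw [lintegral_const_mul _ (hGo.const_mul _), lintegral_const_mul _ hGo]
        by_cases hp : p ∈ D
        · simp [hp, hχ, hlen, h.setLIntegral_chordTimes, hG]
        · simp [hp, hχ]

/-- A property valid almost everywhere in `D` is valid almost everywhere on almost every orbit. -/
theorem ae_orbit [SFinite μ] (h : IsTransientFlow μ Φ D) {P : X → Prop} (hP : ∀ᵐ p ∂(μ.restrict D), P p) :
    ∀ᵐ p ∂(μ.restrict D), ∀ᵐ t ∂(volume.restrict (chordTimes Φ D p)), P (Φ t p) := by
  -- The disintegration formula is applied to the indicator of a measurable null set containing the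
  -- exceptional points.
  obtain ⟨N, hN, hNm, hN0⟩ := exists_measurable_superset_of_null (ae_iff.1 hP)
  have h1 := h.setLIntegral_eq_of_measurable (F := N.indicator fun _ => 1)
    (measurable_const.indicator hNm)
  rw [lintegral_indicator hNm, lintegral_const, one_mul, Measure.restrict_apply_univ,
    hN0, eq_comm] at h1
  have hm := h.measurable_volume_chordTimes.inv.mul
    (h.measurable_setLIntegral_chordTimes (F := N.indicator fun _ => 1)
      (measurable_const.indicator hNm))
  replace h1 := (lintegral_eq_zero_iff hm).1 h1
  filter_upwards [h1, ae_restrict_mem h.measurableSet] with p hp hpD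
  have h2 : ∫⁻ t in chordTimes Φ D p, N.indicator (fun _ => (1 : ℝ≥0∞)) (Φ t p) = 0 := by
    rcases mul_eq_zero.1 hp with h3 | h3
    · exact absurd (ENNReal.inv_eq_zero.1 h3) (h.time_ne_top p hpD)
    · exact h3
  have hm2 : Measurable fun t => N.indicator (fun _ => (1 : ℝ≥0∞)) (Φ t p) :=
    (measurable_const.indicator hNm).comp (h.measurable_orbit p)
  rw [lintegral_eq_zero_iff hm2] at h2
  filter_upwards [h2] with t ht
  by_contra hcon
  simp [show Φ t p ∈ N from hN hcon] at ht

/-- Disintegration along the orbits of a flow. -/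
theorem setLIntegral_eq [SFinite μ] (h : IsTransientFlow μ Φ D) {F : X → ℝ≥0∞}
    (hF : AEMeasurable F (μ.restrict D)) :
    ∫⁻ p in D, F p ∂μ =
      ∫⁻ p in D, (volume (chordTimes Φ D p))⁻¹ * (∫⁻ t in chordTimes Φ D p, F (Φ t p)) ∂μ := by
  rw [lintegral_congr_ae hF.ae_eq_mk, h.setLIntegral_eq_of_measurable hF.measurable_mk]
  refine lintegral_congr_ae ?_
  filter_upwards [h.ae_orbit hF.ae_eq_mk] with p hp
  rw [lintegral_congr_ae hp]

theorem aemeasurable_setLIntegral_chordTimes [SFinite μ] (h : IsTransientFlow μ Φ D) {F : X → ℝ≥0∞}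
    (hF : AEMeasurable F (μ.restrict D)) :
    AEMeasurable (fun p => ∫⁻ t in chordTimes Φ D p, F (Φ t p)) (μ.restrict D) := by
  refine ⟨_, h.measurable_setLIntegral_chordTimes hF.measurable_mk, ?_⟩
  filter_upwards [h.ae_orbit hF.ae_eq_mk] with p hp
  rw [lintegral_congr_ae hp]

/-- A function whose integral vanishes along almost every orbit has zero integral. -/
theorem setIntegral_eq_zero [SFinite μ] (h : IsTransientFlow μ Φ D) {H : X → ℝ} (hH : IntegrableOn H D μ)
    (h0 : ∀ᵐ p ∂(μ.restrict D), IntegrableOn (fun t => H (Φ t p)) (chordTimes Φ D p) ∧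
      ∫ t in chordTimes Φ D p, H (Φ t p) = 0) :
    ∫ p in D, H p ∂μ = 0 := by
  rw [integral_eq_lintegral_pos_part_sub_lintegral_neg_part hH,
    h.setLIntegral_eq hH.aemeasurable.ennreal_ofReal,
    h.setLIntegral_eq (F := fun p => ENNReal.ofReal (-H p)) hH.neg.aemeasurable.ennreal_ofReal, sub_eq_zero]
  congr 1
  -- On almost every orbit the positive and negative parts of `H` have the same finite integral, so
  -- their weighted totals agree.
  refine lintegral_congr_ae ?_
  filter_upwards [h0] with p hp
  congr 1
  have h1 := hp.2
  rw [integral_eq_lintegral_pos_part_sub_lintegral_neg_part hp.1, sub_eq_zero] at h1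
  exact (ENNReal.toReal_eq_toReal_iff' hp.1.lintegral_lt_top.ne hp.1.neg.lintegral_lt_top.ne).1 h1

/-- If `g` is dominated by `f` along almost every orbit, so are the integrals. -/
theorem setLIntegral_le_of_gap [SFinite μ] (h : IsTransientFlow μ Φ D) {f g : X → ℝ≥0∞}
    (hf : AEMeasurable f (μ.restrict D)) (hg : AEMeasurable g (μ.restrict D))
    (hgap : ∀ᵐ p ∂(μ.restrict D), ∃ δ : ℝ, 0 < δ ∧ ENNReal.ofReal (1 + δ) *
      ∫⁻ t in chordTimes Φ D p, g (Φ t p) ≤ ∫⁻ t in chordTimes Φ D p, f (Φ t p)) :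
    ∫⁻ p in D, g p ∂μ ≤ ∫⁻ p in D, f p ∂μ := by
  rw [h.setLIntegral_eq hf, h.setLIntegral_eq hg]
  refine lintegral_mono_ae ?_
  filter_upwards [hgap] with p ⟨δ, hδ, hp⟩
  refine mul_le_mul_right (le_trans ?_ hp) _
  exact le_mul_of_one_le_left' (by
    rw [← ENNReal.ofReal_one]; exact ENNReal.ofReal_le_ofReal (by linarith))

/-- If `g` is dominated by `f` along almost every orbit with a definite gap, while the total
integral of `f` is finite and at most that of `g`, then `f` vanishes. -/
theorem setLIntegral_eq_zero_of_gap [SFinite μ] (h : IsTransientFlow μ Φ D) {f g : X → ℝ≥0∞}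
    (hf : AEMeasurable f (μ.restrict D)) (hg : AEMeasurable g (μ.restrict D))
    (hgap : ∀ᵐ p ∂(μ.restrict D), ∃ δ : ℝ, 0 < δ ∧ ENNReal.ofReal (1 + δ) *
      ∫⁻ t in chordTimes Φ D p, g (Φ t p) ≤ ∫⁻ t in chordTimes Φ D p, f (Φ t p))
    (hfin : ∫⁻ p in D, f p ∂μ ≠ ⊤) (hle : ∫⁻ p in D, f p ∂μ ≤ ∫⁻ p in D, g p ∂μ) :
    ∫⁻ p in D, f p ∂μ = 0 := by
  set A : X → ℝ≥0∞ := fun p => ∫⁻ t in chordTimes Φ D p, f (Φ t p) with hA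
  set B : X → ℝ≥0∞ := fun p => ∫⁻ t in chordTimes Φ D p, g (Φ t p) with hB
  set w : X → ℝ≥0∞ := fun p => (volume (chordTimes Φ D p))⁻¹ with hw
  have hwm : Measurable w := h.measurable_volume_chordTimes.inv
  have hfA : ∫⁻ p in D, f p ∂μ = ∫⁻ p in D, w p * A p ∂μ := h.setLIntegral_eq hf
  have hgB : ∫⁻ p in D, g p ∂μ = ∫⁻ p in D, w p * B p ∂μ := h.setLIntegral_eq hg
  have hAm : AEMeasurable (fun p => w p * A p) (μ.restrict D) :=
    hwm.aemeasurable.mul (h.aemeasurable_setLIntegral_chordTimes hf)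
  have hBA : ∀ᵐ p ∂(μ.restrict D), w p * B p ≤ w p * A p := by
    filter_upwards [hgap] with p ⟨δ, hδ, hp⟩
    refine mul_le_mul_right (le_trans ?_ hp) _
    exact le_mul_of_one_le_left' (by
      rw [← ENNReal.ofReal_one]; exact ENNReal.ofReal_le_ofReal (by linarith))
  have hfin' : ∫⁻ p in D, w p * A p ∂μ ≠ ⊤ := hfA ▸ hfin
  have hBfin : ∫⁻ p in D, w p * B p ∂μ ≠ ⊤ := ne_top_of_le_ne_top hfin' (lintegral_mono_ae hBA)
  -- An inequality between orbit integrals whose totals are finite and ordered the other way is an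
  -- equality almost everywhere. Then `(1 + δ) A ≤ A` with `A` finite leaves only `A = 0`.
  have heq := ae_eq_of_ae_le_of_lintegral_le hBA hBfin hAm (by rw [← hfA, ← hgB]; exact hle)
  rw [hfA, lintegral_eq_zero_iff' hAm]
  filter_upwards [heq, hgap, ae_lt_top' hAm hfin', ae_restrict_mem h.measurableSet]
    with p hp ⟨δ, hδ, hpδ⟩ hlt hpD
  have hw0 : w p ≠ 0 := ENNReal.inv_ne_zero.2 (h.time_ne_top p hpD)
  have hwt : w p ≠ ⊤ := ENNReal.inv_ne_top.2 (h.time_ne_zero p hpD)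
  have hAB : B p = A p := (ENNReal.mul_right_inj hw0 hwt).1 hp
  have hAt : A p ≠ ⊤ := fun hcon => by
    rw [hcon, ENNReal.mul_top hw0] at hlt; exact lt_irrefl _ hlt
  have hA0 : A p = 0 := by
    change ENNReal.ofReal (1 + δ) * B p ≤ A p at hpδ
    rw [hAB, ← ENNReal.ofReal_toReal hAt, ← ENNReal.ofReal_mul (by positivity),
      ENNReal.ofReal_le_ofReal_iff ENNReal.toReal_nonneg] at hpδ
    have h3 : (A p).toReal = 0 := by nlinarith [ENNReal.toReal_nonneg (a := A p)]
    exact ((ENNReal.toReal_eq_zero_iff _).1 h3).resolve_right hAt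
  simp [hA0]

end IsTransientFlow

/-! ### Monotonicity, scaling and bounds for the Planck distribution -/

section Planck

variable {h c k : ℝ}

theorem planck_zero (ν : ℝ) : planck h c k ν 0 = 0 := by simp [planck]

/-- Two Taylor terms are kept: the cubic one cancels the factor `ν³` of the Planck distribution, and
the quintic one leaves the integrable decay `ν⁻²`. -/
theorem exp_sub_one_ge {y : ℝ} (hy : 0 ≤ y) : (y ^ 3 + y ^ 5) / 120 ≤ Real.exp y - 1 := by
  have h1 := Real.sum_le_exp_of_nonneg hy 6
  simp only [Finset.sum_range_succ, Finset.sum_range_zero, Nat.factorial] at h1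
  norm_num at h1
  have : 0 ≤ y ^ 2 := by positivity
  have : 0 ≤ y ^ 3 := by positivity
  have : 0 ≤ y ^ 4 := by positivity
  linarith

theorem planck_nonneg (hh : 0 < h) (hk : 0 < k) {ν T : ℝ} (hν : 0 < ν) (hT : 0 ≤ T) :
    0 ≤ planck h c k ν T := by
  have h1 : 1 ≤ Real.exp (h * ν / (k * T)) := Real.one_le_exp (by positivity)
  have h2 : 0 ≤ 1 / (Real.exp (h * ν / (k * T)) - 1) := one_div_nonneg.2 (by linarith)
  unfold planck
  positivity

theorem planck_pos (hh : 0 < h) (hc : 0 < c) (hk : 0 < k) {ν T : ℝ} (hν : 0 < ν) (hT : 0 < T) :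
    0 < planck h c k ν T := by
  have h1 : 1 < Real.exp (h * ν / (k * T)) := Real.one_lt_exp_iff.2 (by positivity)
  have h2 : 0 < 1 / (Real.exp (h * ν / (k * T)) - 1) := one_div_pos.2 (by linarith)
  unfold planck
  positivity

/-- The endpoint `T = 0` is included: division by zero gives the value `0` there, below every value
at a positive temperature. -/
theorem planck_strictMonoOn (hh : 0 < h) (hc : 0 < c) (hk : 0 < k) {ν : ℝ} (hν : 0 < ν) :
    StrictMonoOn (planck h c k ν) (Ici 0) := by
  intro S hS T _ hST
  rcases eq_or_lt_of_le (show 0 ≤ S from hS) with rfl | hS'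
  · rw [planck_zero]
    exact planck_pos hh hc hk hν hST
  · have hT' : 0 < T := hS'.trans hST
    have h1 : 1 < Real.exp (h * ν / (k * T)) := Real.one_lt_exp_iff.2 (by positivity)
    have h2 : Real.exp (h * ν / (k * T)) < Real.exp (h * ν / (k * S)) := by
      apply Real.exp_lt_exp.2
      gcongr
    have h3 : 1 / (Real.exp (h * ν / (k * S)) - 1) < 1 / (Real.exp (h * ν / (k * T)) - 1) :=
      one_div_lt_one_div_of_lt (by linarith) (by linarith)
    unfold planck
    gcongr

theorem measurable_planck (h c k : ℝ) : Measurable fun q : ℝ × ℝ => planck h c k q.1 q.2 := by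
  unfold planck
  fun_prop

/-- Homogeneity of the Planck distribution. -/
theorem planck_scale (hk : 0 < k) {ν T : ℝ} (hT : 0 < T) :
    planck h c k ν T = T ^ 3 * planck h c k (T⁻¹ * ν) 1 := by
  unfold planck
  have : h * (T⁻¹ * ν) / (k * 1) = h * ν / (k * T) := by field_simp
  rw [this]
  field_simp

/-- By scaling, this one bound at temperature `1` yields both the uniform bound by `T ^ 3` and the
integrability behind the `T ^ 4` law. -/
theorem planck_one_le (hh : 0 < h) (hc : 0 < c) (hk : 0 < k) :
    ∃ A : ℝ, 0 < A ∧ ∀ ν : ℝ, 0 < ν → planck h c k ν 1 ≤ A * (1 + ν ^ 2)⁻¹ := by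
  set m : ℝ := min ((h / k) ^ 3) ((h / k) ^ 5) with hm
  have hm0 : 0 < m := lt_min (by positivity) (by positivity)
  refine ⟨2 * h / c ^ 2 * (120 / m), by positivity, fun ν hν => ?_⟩
  have h1 := exp_sub_one_ge (y := h * ν / (k * 1)) (by positivity)
  have h2 : m * (ν ^ 3 * (1 + ν ^ 2)) / 120 ≤ Real.exp (h * ν / (k * 1)) - 1 := by
    refine le_trans ?_ h1
    have e1 : m * ν ^ 3 ≤ (h / k) ^ 3 * ν ^ 3 := by gcongr; exact min_le_left _ _
    have e2 : m * ν ^ 5 ≤ (h / k) ^ 5 * ν ^ 5 := by gcongr; exact min_le_right _ _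
    have e3 : h * ν / (k * 1) = h / k * ν := by rw [mul_one]; ring
    rw [e3, mul_pow, mul_pow]
    linarith
  have h3 : 1 / (Real.exp (h * ν / (k * 1)) - 1) ≤ 1 / (m * (ν ^ 3 * (1 + ν ^ 2)) / 120) :=
    one_div_le_one_div_of_le (by positivity) h2
  unfold planck
  calc 2 * h * ν ^ 3 / c ^ 2 * (1 / (Real.exp (h * ν / (k * 1)) - 1))
      ≤ 2 * h * ν ^ 3 / c ^ 2 * (1 / (m * (ν ^ 3 * (1 + ν ^ 2)) / 120)) := by gcongr
    _ = _ := by field_simp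

/-- The Planck distribution is bounded by a multiple of the cube of the temperature. -/
theorem planck_le_cube (hh : 0 < h) (hc : 0 < c) (hk : 0 < k) :
    ∃ A : ℝ, 0 < A ∧ ∀ ν T : ℝ, 0 < ν → 0 ≤ T → planck h c k ν T ≤ A * T ^ 3 := by
  obtain ⟨A, hA, hle⟩ := planck_one_le hh hc hk
  refine ⟨A, hA, fun ν T hν hT => ?_⟩
  rcases eq_or_lt_of_le hT with rfl | hT'
  · simp [planck_zero]
  rw [planck_scale hk hT', mul_comm A]
  have h1 : (1 + (T⁻¹ * ν) ^ 2)⁻¹ ≤ 1 := inv_le_one_of_one_le₀ (by nlinarith [sq_nonneg (T⁻¹ * ν)])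
  have h2 := hle (T⁻¹ * ν) (by positivity)
  gcongr
  nlinarith

theorem integrableOn_planck_one (hh : 0 < h) (hc : 0 < c) (hk : 0 < k) :
    IntegrableOn (fun ν => planck h c k ν 1) (Ioi 0) := by
  obtain ⟨A, hA, hle⟩ := planck_one_le hh hc hk
  refine Integrable.mono' (integrable_inv_one_add_sq.const_mul A).integrableOn ?_ ?_
  · exact ((measurable_planck h c k).comp
      (measurable_id.prodMk measurable_const)).aestronglyMeasurable
  · filter_upwards [ae_restrict_mem measurableSet_Ioi] with ν hν
    rw [Real.norm_of_nonneg (planck_nonneg hh hk hν zero_le_one)]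
    exact hle ν hν

/-- The Stefan-Boltzmann law. -/
theorem lintegral_planck (hh : 0 < h) (hc : 0 < c) (hk : 0 < k) :
    ∃ σ : ℝ, 0 ≤ σ ∧ ∀ T : ℝ, 0 ≤ T →
      ∫⁻ ν in Ioi (0 : ℝ), ENNReal.ofReal (planck h c k ν T) = ENNReal.ofReal (σ * T ^ 4) := by
  refine ⟨∫ ν in Ioi (0 : ℝ), planck h c k ν 1,
    setIntegral_nonneg measurableSet_Ioi fun ν hν => planck_nonneg hh hk hν zero_le_one,
    fun T hT => ?_⟩
  rcases eq_or_lt_of_le hT with rfl | hT'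
  · simp [planck_zero]
  have h1 : IntegrableOn (fun ν => planck h c k (T⁻¹ * ν) 1) (Ioi 0) := by
    rw [integrableOn_Ioi_comp_mul_left_iff (fun ν => planck h c k ν 1) 0 (inv_pos.2 hT'), mul_zero]
    exact integrableOn_planck_one hh hc hk
  have h2 : (fun ν => planck h c k ν T) = fun ν => T ^ 3 * planck h c k (T⁻¹ * ν) 1 :=
    funext fun ν => planck_scale hk hT'
  have h3 : IntegrableOn (fun ν => planck h c k ν T) (Ioi 0) := by
    rw [h2]; exact h1.const_mul _
  rw [← ofReal_integral_eq_lintegral_ofReal h3]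
  · congr 1
    -- The fourth power is the factor `T ^ 3` from homogeneity times the Jacobian `T` of the change
    -- of frequency.
    rw [h2, integral_const_mul,
      integral_comp_mul_left_Ioi (fun ν => planck h c k ν 1) 0 (inv_pos.2 hT'), mul_zero, inv_inv,
      smul_eq_mul]
    ring
  · filter_upwards [ae_restrict_mem measurableSet_Ioi] with ν hν
    exact planck_nonneg hh hk hν hT

end Planck

/-! ### Geometry of chords in a convex domain -/

theorem inner_gradient_eq_fderiv (f : Space → ℝ) (x v : Space) :
    inner ℝ (gradient f x) v = fderiv ℝ f x v := by
  rw [← toDual_gradient, InnerProductSpace.toDual_apply_apply]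

theorem hasDerivAt_comp_line {f : Space → ℝ} {x v : Space} {t : ℝ}
    (hf : DifferentiableAt ℝ f (x + t • v)) :
    HasDerivAt (fun s : ℝ => f (x + s • v)) (inner ℝ (gradient f (x + t • v)) v) t := by
  rw [inner_gradient_eq_fderiv]
  have h1 : HasDerivAt (fun s : ℝ => x + s • v) v t := by
    simpa using ((hasDerivAt_id t).smul_const v).const_add x
  exact hf.hasFDerivAt.comp_hasDerivAt t h1

/-- In a convex open set, the first boundary point met backwards from an interior point is an
incoming one. -/
theorem isIncoming_of_frontier {Ω : Set Space} (hΩo : IsOpen Ω) (hΩc : Convex ℝ Ω)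
    (hΩ1 : HasC1Boundary Ω) {y : Space} (hy : y ∈ frontier Ω) {n : Direction} {τ : ℝ} (hτ : 0 < τ)
    (hx : y + τ • (n : Space) ∈ Ω) : IsIncoming Ω y n := by
  obtain ⟨U, ρ, hρ⟩ := hΩ1 y hy
  set w := gradient ρ y with hw
  have hw0 : w ≠ 0 := hρ.gradient_ne_zero
  refine ⟨‖w‖⁻¹ • w, ⟨hy, U, ρ, hρ, rfl⟩, ?_⟩
  have hyU : U ∈ 𝓝 y := hρ.isOpen.mem_nhds hρ.mem
  have hyΩ : y ∉ Ω := fun h => by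
    rw [hΩo.frontier_eq] at hy
    exact hy.2 h
  have hyc : y ∈ closure Ω := frontier_subset_closure hy
  have hρy : 0 ≤ ρ y := not_lt.1 fun h => hyΩ ((hρ.mem_iff y hρ.mem).2 h)
  have hdiff : DifferentiableAt ℝ ρ y :=
    (hρ.contDiffOn.contDiffAt hyU).differentiableAt (by norm_num)
  -- The gradient supports `Ω` at `y`: the segment from `y` to `z` lies in `Ω` after its start,
  -- where `ρ < 0 ≤ ρ y`, so the derivative of `ρ` along it is at most `0`.
  have hle : ∀ z ∈ Ω, inner ℝ w (z - y) ≤ 0 := by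
    intro z hz
    have hd : HasDerivAt (fun s : ℝ => ρ (y + s • (z - y))) (inner ℝ w (z - y)) 0 := by
      have := hasDerivAt_comp_line (f := ρ) (x := y) (v := z - y) (t := 0) (by simpa using hdiff)
      rwa [zero_smul, add_zero] at this
    refine le_of_tendsto hd.tendsto_slope_zero_right ?_
    have hcont : Tendsto (fun s : ℝ => y + s • (z - y)) (𝓝[>] 0) (𝓝 y) := by
      have : Continuous fun s : ℝ => y + s • (z - y) := by fun_prop
      simpa using (this.tendsto 0).mono_left nhdsWithin_le_nhds
    filter_upwards [hcont.eventually hyU, Ioc_mem_nhdsGT (zero_lt_one (α := ℝ))] with s hsU hs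
    have h1 : y + s • (z - y) ∈ Ω := interior_subset
      (hΩc.add_smul_sub_mem_interior' hyc (by rwa [hΩo.interior_eq]) hs)
    have h2 := (hρ.mem_iff _ hsU).1 h1
    simp only [zero_add, zero_smul, add_zero, smul_eq_mul]
    exact mul_nonpos_of_nonneg_of_nonpos (inv_nonneg.2 hs.1.le) (by linarith)
  -- Strictness comes from openness: the interior point is pushed a little in the direction `w`, and
  -- the supporting inequality gives `τ⟪w, n⟫ ≤ -ε‖w‖² < 0`.
  obtain ⟨ε, hε, hεΩ⟩ : ∃ ε : ℝ, 0 < ε ∧ y + τ • (n : Space) + ε • w ∈ Ω := by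
    have hcont : Tendsto (fun s : ℝ => y + τ • (n : Space) + s • w) (𝓝[>] 0)
        (𝓝 (y + τ • (n : Space))) := by
      have : Continuous fun s : ℝ => y + τ • (n : Space) + s • w := by fun_prop
      simpa using (this.tendsto 0).mono_left nhdsWithin_le_nhds
    obtain ⟨ε, h1, h2⟩ := ((hcont.eventually (hΩo.mem_nhds hx)).and self_mem_nhdsWithin).exists
    exact ⟨ε, h2, h1⟩
  have h1 := hle _ hεΩ
  have e1 : y + τ • (n : Space) + ε • w - y = τ • (n : Space) + ε • w := by abel
  rw [e1, inner_add_right, inner_smul_right, inner_smul_right, real_inner_self_eq_norm_sq] at h1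
  have hwn : 0 < ‖w‖ := norm_pos_iff.2 hw0
  have h2 : 0 < ε * ‖w‖ ^ 2 := by positivity
  have h3 : inner ℝ w (n : Space) < 0 := by
    by_contra! hcon
    nlinarith [mul_nonneg hτ.le hcon]
  rw [inner_smul_right, real_inner_comm]
  exact mul_neg_of_pos_of_neg (inv_pos.2 hwn) h3

/-- A line meets a bounded convex open set with `C¹` boundary in an open segment, whose initial
point is an incoming boundary point. -/
theorem exists_chord {Ω : Set Space} (hΩo : IsOpen Ω) (hΩb : Bornology.IsBounded Ω)
    (hΩc : Convex ℝ Ω) (hΩ1 : HasC1Boundary Ω) {x : Space} (hx : x ∈ Ω) (n : Direction) :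
    ∃ a b : ℝ, a < 0 ∧ 0 < b ∧ {t : ℝ | x + t • (n : Space) ∈ Ω} = Ioo a b ∧
      IsIncoming Ω (x + a • (n : Space)) n := by
  set S : Set ℝ := {t : ℝ | x + t • (n : Space) ∈ Ω} with hS
  have hcont : Continuous fun t : ℝ => x + t • (n : Space) := by fun_prop
  have hSo : IsOpen S := hΩo.preimage hcont
  have h0 : (0 : ℝ) ∈ S := by simpa [hS] using hx
  have hn : ‖(n : Space)‖ = 1 := by simp
  have hSc : Convex ℝ S := by
    intro s hs t ht α β hα hβ hαβ
    have h1 := hΩc hs ht hα hβ hαβ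
    have h2 : α • (x + s • (n : Space)) + β • (x + t • (n : Space)) =
        x + (α • s + β • t) • (n : Space) := by
      have : x = (α + β) • x := by rw [hαβ, one_smul]
      conv_rhs => rw [this]
      module
    rw [h2] at h1
    exact h1
  have hSb : Bornology.IsBounded S := by
    obtain ⟨R, hR⟩ := hΩb.subset_ball x
    refine (Metric.isBounded_ball (x := (0 : ℝ)) (r := R)).subset fun t ht => ?_
    have h1 := hR ht
    simpa [norm_smul, hn] using h1
  have hSbb := hSb.bddBelow
  have hSba := hSb.bddAbove
  have hSconn : IsConnected S := ⟨⟨0, h0⟩, hSc.isPreconnected⟩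
  -- An open set of reals contains neither its infimum nor its supremum.
  have hga : ∀ z, IsGLB S z → z ∉ S := fun z hz hzS => by
    obtain ⟨s, hs, hsz⟩ := Filter.nonempty_of_mem (inter_mem
      (mem_nhdsWithin_of_mem_nhds (hSo.mem_nhds hzS)) (self_mem_nhdsWithin (s := Iio z)))
    exact absurd (hz.1 hs) (not_le.2 hsz)
  have hgb : ∀ z, IsLUB S z → z ∉ S := fun z hz hzS => by
    obtain ⟨s, hs, hsz⟩ := Filter.nonempty_of_mem (inter_mem
      (mem_nhdsWithin_of_mem_nhds (hSo.mem_nhds hzS)) (self_mem_nhdsWithin (s := Ioi z)))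
    exact absurd (hz.1 hs) (not_le.2 hsz)
  have hglb := isGLB_csInf ⟨0, h0⟩ hSbb
  have hlub := isLUB_csSup ⟨0, h0⟩ hSba
  have ha0 := hga _ hglb
  have hb0 := hgb _ hlub
  have hlt : ∀ t ∈ S, sInf S < t := fun t ht =>
    lt_of_le_of_ne (hglb.1 ht) fun h => ha0 (h ▸ ht)
  have hgt : ∀ t ∈ S, t < sSup S := fun t ht =>
    lt_of_le_of_ne (hlub.1 ht) fun h => hb0 (h ▸ ht)
  refine ⟨sInf S, sSup S, hlt 0 h0, hgt 0 h0,
    Subset.antisymm (fun t ht => ⟨hlt t ht, hgt t ht⟩)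
      (hSconn.Ioo_csInf_csSup_subset hSbb hSba), ?_⟩
  refine isIncoming_of_frontier hΩo hΩc hΩ1 ?_ (τ := -sInf S) (by linarith [hlt 0 h0]) ?_
  · rw [hΩo.frontier_eq]
    refine ⟨?_, ha0⟩
    have h1 : sInf S ∈ closure S := csInf_mem_closure ⟨0, h0⟩ hSbb
    exact map_mem_closure (f := fun t : ℝ => x + t • (n : Space)) hcont h1 fun t ht => ht
  · simpa using hx

/-! ### Phase space, its measures and the free transport flow -/

instance : IsFiniteMeasure dirMeasure := by unfold dirMeasure; infer_instance

theorem dirMeasure_ne_zero : dirMeasure ≠ 0 := by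
  intro h
  have h1 : dirMeasure univ = 0 := by simp [h]
  rw [dirMeasure, Measure.toSphere_apply_univ] at h1
  simp only [mul_eq_zero, Nat.cast_eq_zero] at h1
  rcases h1 with h1 | h1
  · simp at h1
  · exact (Metric.measure_ball_pos volume (0 : Space) one_pos).ne' h1

/-- The free transport flow on phase space. -/
noncomputable def transportFlow (t : ℝ) (p : ℝ × Space × Direction) : ℝ × Space × Direction :=
  (p.1, p.2.1 + t • (p.2.2 : Space), p.2.2)

/-- The measure `dν dx dn` on the whole phase space. -/
noncomputable def fullMeasure : Measure (ℝ × Space × Direction) :=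
  (volume : Measure ℝ).prod ((volume : Measure Space).prod dirMeasure)

/-- The part of phase space with positive frequency and position in `Ω`. -/
def phaseDomain (Ω : Set Space) : Set (ℝ × Space × Direction) := Ioi 0 ×ˢ (Ω ×ˢ univ)

instance : SFinite fullMeasure := by unfold fullMeasure; infer_instance

theorem phaseMeasure_eq (Ω : Set Space) :
    phaseMeasure Ω = fullMeasure.restrict (phaseDomain Ω) := by
  rw [phaseMeasure, fullMeasure, phaseDomain, ← Measure.prod_restrict, ← Measure.prod_restrict,
    Measure.restrict_univ]

theorem measurable_transportFlow :
    Measurable fun q : ℝ × (ℝ × Space × Direction) => transportFlow q.1 q.2 := by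
  unfold transportFlow
  have : Measurable fun q : ℝ × (ℝ × Space × Direction) => (q.2.2.2 : Space) :=
    measurable_subtype_coe.comp (by fun_prop)
  fun_prop

/-- For a fixed direction the flow is a translation in space, so it is a skew product over the
directions. The swaps put the direction first, as the base of the skew product. -/
theorem measurePreserving_transportFlow (t : ℝ) :
    MeasurePreserving (transportFlow t) fullMeasure fullMeasure := by
  have h1 : MeasurePreserving (fun q : Direction × Space => (q.1, q.2 + t • (q.1 : Space)))
      (dirMeasure.prod volume) (dirMeasure.prod volume) := by
    refine MeasurePreserving.skew_product (f := id)
      (g := fun (n : Direction) (x : Space) => x + t • (n : Space)) (MeasurePreserving.id _)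
      ?_ (Eventually.of_forall fun n => map_add_right_eq_self _ _)
    have : Measurable fun q : Direction × Space => (q.1 : Space) :=
      measurable_subtype_coe.comp measurable_fst
    simp only [Function.uncurry_def]
    fun_prop
  have h2 := (Measure.measurePreserving_swap.comp h1).comp
    (Measure.measurePreserving_swap (μ := (volume : Measure Space)) (ν := dirMeasure))
  exact (MeasurePreserving.id (volume : Measure ℝ)).prod h2

theorem chordTimes_transportFlow {Ω : Set Space} {p : ℝ × Space × Direction} (hp : 0 < p.1) :
    chordTimes transportFlow (phaseDomain Ω) p =
      {t : ℝ | p.2.1 + t • (p.2.2 : Space) ∈ Ω} := by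
  ext t
  simp [chordTimes, transportFlow, phaseDomain, hp]

/-- Orbits through the domain meet it in chords: these are nonempty open segments, of finite length
because `Ω` is bounded. -/
theorem isTransientFlow {Ω : Set Space} (hΩo : IsOpen Ω) (hΩb : Bornology.IsBounded Ω)
    (hΩc : Convex ℝ Ω) (hΩ1 : HasC1Boundary Ω) :
    IsTransientFlow fullMeasure transportFlow (phaseDomain Ω) where
  measurable := measurable_transportFlow
  preserving := measurePreserving_transportFlow
  comp s t p := by
    simp only [transportFlow, Prod.mk.injEq, true_and, and_true]
    module
  zero p := by simp [transportFlow]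
  measurableSet := measurableSet_Ioi.prod (hΩo.measurableSet.prod MeasurableSet.univ)
  time_ne_zero p hp := by
    obtain ⟨a, b, ha, hb, hab, -⟩ := exists_chord hΩo hΩb hΩc hΩ1 hp.2.1 p.2.2
    rw [chordTimes_transportFlow hp.1, hab, Real.volume_Ioo]
    simpa using ha.trans hb
  time_ne_top p hp := by
    obtain ⟨a, b, ha, hb, hab, -⟩ := exists_chord hΩo hΩb hΩc hΩ1 hp.2.1 p.2.2
    rw [chordTimes_transportFlow hp.1, hab, Real.volume_Ioo]
    exact ENNReal.ofReal_ne_top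

/-- The measure `dν dn` on positive frequencies and directions. -/
noncomputable def radiationMeasure : Measure (ℝ × Direction) :=
  ((volume : Measure ℝ).restrict (Ioi 0)).prod dirMeasure

instance : SFinite radiationMeasure := by unfold radiationMeasure; infer_instance

theorem radiationMeasure_ne_zero : radiationMeasure ≠ 0 := by
  intro h
  have h1 : radiationMeasure univ = 0 := by simp [h]
  rw [radiationMeasure, ← univ_prod_univ, Measure.prod_prod] at h1
  simp [dirMeasure_ne_zero] at h1

/-- Reordering of the phase space variables. -/
def reorder (q : Space × ℝ × Direction) : ℝ × Space × Direction := (q.2.1, q.1, q.2.2)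

/-- The energy balance holds at fixed `x`, so Fubini is needed with position as the outer variable.
-/
theorem measurePreserving_reorder (Ω : Set Space) :
    MeasurePreserving reorder ((volume.restrict Ω).prod radiationMeasure) (phaseMeasure Ω) := by
  have h1 : MeasurePreserving MeasurableEquiv.prodAssoc.symm
      (((volume : Measure Space).restrict Ω).prod radiationMeasure) _ :=
    (measurePreserving_prodAssoc ((volume : Measure Space).restrict Ω)
      ((volume : Measure ℝ).restrict (Ioi 0)) dirMeasure).symm
  have h2 := (Measure.measurePreserving_swap (μ := (volume : Measure Space).restrict Ω)
    (ν := (volume : Measure ℝ).restrict (Ioi 0))).prod (MeasurePreserving.id dirMeasure)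
  have h3 := measurePreserving_prodAssoc ((volume : Measure ℝ).restrict (Ioi 0))
      ((volume : Measure Space).restrict Ω) dirMeasure
  exact h3.comp (h2.comp h1)

theorem ae_ae_of_ae_phase {Ω : Set Space} {P : ℝ × Space × Direction → Prop}
    (hP : ∀ᵐ p ∂(phaseMeasure Ω), P p) :
    ∀ᵐ x ∂(volume.restrict Ω), ∀ᵐ q ∂radiationMeasure, P (q.1, x, q.2) :=
  Measure.ae_ae_of_ae_prod ((measurePreserving_reorder Ω).quasiMeasurePreserving.ae hP)

theorem lintegral_phase {Ω : Set Space} {f : ℝ × Space × Direction → ℝ≥0∞}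
    (hf : AEMeasurable f (phaseMeasure Ω)) :
    ∫⁻ p, f p ∂(phaseMeasure Ω) =
      ∫⁻ x in Ω, ∫⁻ q, f (q.1, x, q.2) ∂radiationMeasure := by
  have h1 := measurePreserving_reorder Ω
  rw [← h1.map_eq] at hf ⊢
  rw [lintegral_map' hf h1.aemeasurable, lintegral_prod (fun q => f (reorder q)) (hf.comp_aemeasurable h1.aemeasurable)]
  rfl

theorem integrable_reorder {E : Type*} [NormedAddCommGroup E] {Ω : Set Space}
    {f : ℝ × Space × Direction → E} (hf : Integrable f (phaseMeasure Ω)) :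
    Integrable (fun q : Space × ℝ × Direction => f (q.2.1, q.1, q.2.2))
      ((volume.restrict Ω).prod radiationMeasure) :=
  (measurePreserving_reorder Ω).integrable_comp_of_integrable hf

theorem integral_phase {E : Type*} [NormedAddCommGroup E] [NormedSpace ℝ E] {Ω : Set Space}
    {f : ℝ × Space × Direction → E} (hf : Integrable f (phaseMeasure Ω)) :
    ∫ p, f p ∂(phaseMeasure Ω) = ∫ x in Ω, ∫ q, f (q.1, x, q.2) ∂radiationMeasure := by
  have h1 := measurePreserving_reorder Ω
  rw [← h1.map_eq, integral_map h1.aemeasurable (by rw [h1.map_eq]; exact hf.1)]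
  exact integral_prod _ (integrable_reorder hf)

theorem quasiMeasurePreserving_position (Ω : Set Space) :
    Measure.QuasiMeasurePreserving (fun p : ℝ × Space × Direction => p.2.1) (phaseMeasure Ω)
      (volume.restrict Ω) :=
  Measure.quasiMeasurePreserving_fst.comp Measure.quasiMeasurePreserving_snd

theorem ae_phase_mem {Ω : Set Space} (hΩo : IsOpen Ω) :
    ∀ᵐ p ∂(phaseMeasure Ω), 0 < p.1 ∧ p.2.1 ∈ Ω := by
  rw [phaseMeasure_eq]
  filter_upwards [ae_restrict_mem
    (measurableSet_Ioi.prod (hΩo.measurableSet.prod MeasurableSet.univ))] with p hp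
  exact ⟨hp.1, hp.2.1⟩

/-! ### Finiteness of the emitted energy -/

section Source

variable {h c k : ℝ} {Ω : Set Space} {κ : ℝ → Space → ℝ} {T : Space → ℝ} {T₀ : ℝ}

theorem aemeasurable_planck_phase (hTm : AEMeasurable T (volume.restrict Ω)) :
    AEMeasurable (fun p : ℝ × Space × Direction => planck h c k p.1 (T p.2.1))
      (phaseMeasure Ω) := by
  have h0 : AEMeasurable (fun p : ℝ × Space × Direction => T p.2.1) (phaseMeasure Ω) :=
    hTm.comp_quasiMeasurePreserving (quasiMeasurePreserving_position Ω)
  have h1 : AEMeasurable (fun p : ℝ × Space × Direction => (p.1, T p.2.1)) (phaseMeasure Ω) :=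
    AEMeasurable.prodMk (f := fun p : ℝ × Space × Direction => p.1) measurable_fst.aemeasurable h0
  simpa only [Function.comp_def] using (measurable_planck h c k).comp_aemeasurable h1

theorem measurable_planck_const (h c k T₀ : ℝ) :
    Measurable fun p : ℝ × Space × Direction => planck h c k p.1 T₀ :=
  Measurable.comp (g := fun q : ℝ × ℝ => planck h c k q.1 q.2)
    (f := fun p : ℝ × Space × Direction => (p.1, T₀))
    (measurable_planck h c k) (measurable_fst.prodMk measurable_const)

theorem measurable_absorption (hκm : Measurable (Function.uncurry κ)) :
    Measurable fun p : ℝ × Space × Direction => κ p.1 p.2.1 :=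
  hκm.comp (measurable_fst.prodMk (measurable_fst.comp measurable_snd))

theorem lintegral_radiationMeasure {f : ℝ → ℝ≥0∞}
    (hf : AEMeasurable f (volume.restrict (Ioi 0))) :
    ∫⁻ q, f q.1 ∂radiationMeasure = (∫⁻ ν in Ioi (0 : ℝ), f ν) * dirMeasure univ := by
  have h1 := lintegral_prod_mul (μ := (volume : Measure ℝ).restrict (Ioi 0)) (ν := dirMeasure)
    (f := f) (g := fun _ => 1) hf aemeasurable_const
  simpa [radiationMeasure] using h1

/-- For a bounded absorption coefficient the emitted energy is finite if `T ∈ L⁴`. -/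
theorem lintegral_emission_ne_top_of_memLp (hh : 0 < h) (hc : 0 < c) (hk : 0 < k)
    (hΩo : IsOpen Ω) (hΩb : Bornology.IsBounded Ω) (hT₀ : 0 < T₀)
    (hκ : ∀ ν : ℝ, 0 < ν → ∀ x ∈ Ω, 0 < κ ν x)
    (hT0 : ∀ᵐ x ∂(volume.restrict Ω), 0 ≤ T x)
    {C : ℝ} (hC : ∀ ν : ℝ, 0 < ν → ∀ x ∈ Ω, κ ν x ≤ C) (hT : MemLp T 4 (volume.restrict Ω)) :
    ∫⁻ p, ENNReal.ofReal (κ p.1 p.2.1 * |planck h c k p.1 (T p.2.1) - planck h c k p.1 T₀|)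
      ∂(phaseMeasure Ω) ≠ ⊤ := by
  obtain ⟨σ, hσ, hσT⟩ := lintegral_planck hh hc hk
  have hpm : ∀ S : ℝ, Measurable fun ν => ENNReal.ofReal (planck h c k ν S) := fun S =>
    ((measurable_planck h c k).comp (measurable_id.prodMk measurable_const)).ennreal_ofReal
  have hT4 : Integrable (fun x => T x ^ 4) (volume.restrict Ω) := by
    refine (hT.integrable_norm_pow (by norm_num)).congr ?_
    filter_upwards [hT0] with x hx
    rw [Real.norm_of_nonneg hx]
  have hΩfin : IsFiniteMeasure ((volume : Measure Space).restrict Ω) :=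
    ⟨by simpa using hΩb.measure_lt_top⟩
  -- The majorant uses `|B(T) - B(T₀)| ≤ B(T) + B(T₀)`. Its integral over frequencies is a multiple
  -- of `T ^ 4 + T₀ ^ 4`, which is why `T` is required to be in `L⁴`.
  set F : ℝ × Space × Direction → ℝ≥0∞ := fun p => ENNReal.ofReal C *
    (ENNReal.ofReal (planck h c k p.1 (T p.2.1)) + ENNReal.ofReal (planck h c k p.1 T₀)) with hF
  have hFm : AEMeasurable F (phaseMeasure Ω) :=
    ((aemeasurable_planck_phase hT.1.aemeasurable).ennreal_ofReal.add
      (measurable_planck_const h c k T₀).ennreal_ofReal.aemeasurable).const_mul _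
  refine ne_top_of_le_ne_top (b := ∫⁻ p, F p ∂(phaseMeasure Ω)) ?_ (lintegral_mono_ae ?_)
  · rw [lintegral_phase hFm]
    have h1 : ∀ᵐ x ∂((volume : Measure Space).restrict Ω),
        ∫⁻ q, F (q.1, x, q.2) ∂radiationMeasure =
          ENNReal.ofReal C * (dirMeasure univ * ENNReal.ofReal (σ * T x ^ 4 + σ * T₀ ^ 4)) := by
      filter_upwards [hT0] with x hx
      have hm : Measurable fun ν => ENNReal.ofReal (planck h c k ν (T x)) +
          ENNReal.ofReal (planck h c k ν T₀) := (hpm _).add (hpm _)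
      simp only [hF]
      rw [lintegral_const_mul' _ _ ENNReal.ofReal_ne_top,
        lintegral_radiationMeasure (f := fun ν => ENNReal.ofReal (planck h c k ν (T x)) +
          ENNReal.ofReal (planck h c k ν T₀)) hm.aemeasurable,
        lintegral_add_left (hpm _), hσT _ hx, hσT _ hT₀.le,
        ← ENNReal.ofReal_add (by positivity) (by positivity), mul_comm (dirMeasure univ)]
    rw [lintegral_congr_ae h1, lintegral_const_mul' _ _ ENNReal.ofReal_ne_top,
      lintegral_const_mul' _ _ (measure_ne_top _ _)]
    refine ENNReal.mul_ne_top ENNReal.ofReal_ne_top (ENNReal.mul_ne_top (measure_ne_top _ _) ?_)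
    exact ((hT4.const_mul σ).add (integrable_const (σ * T₀ ^ 4))).lintegral_lt_top.ne
  · filter_upwards [ae_phase_mem hΩo,
      (quasiMeasurePreserving_position Ω).ae hT0] with p hp hTp
    have h0 := hκ _ hp.1 _ hp.2
    have h1 := hC _ hp.1 _ hp.2
    have h2 := planck_nonneg (c := c) hh hk hp.1 hTp
    have h3 := planck_nonneg (c := c) hh hk hp.1 hT₀.le
    rw [hF]
    simp only
    rw [← ENNReal.ofReal_add h2 h3, ← ENNReal.ofReal_mul (h0.le.trans h1)]
    refine ENNReal.ofReal_le_ofReal (mul_le_mul h1 ?_ (abs_nonneg _) (h0.le.trans h1))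
    rw [abs_le]
    constructor <;> linarith

/-- For an integrable absorption profile the emitted energy is finite if `T` is bounded. -/
theorem lintegral_emission_ne_top_of_bounded (hh : 0 < h) (hc : 0 < c) (hk : 0 < k)
    (hΩo : IsOpen Ω) (hΩb : Bornology.IsBounded Ω) (hT₀ : 0 < T₀)
    (hκ : ∀ ν : ℝ, 0 < ν → ∀ x ∈ Ω, 0 < κ ν x)
    (hT0 : ∀ᵐ x ∂(volume.restrict Ω), 0 ≤ T x)
    {α : ℝ → ℝ} (hα : IntegrableOn α (Ioi 0)) (hC : ∀ ν : ℝ, 0 < ν → ∀ x ∈ Ω, κ ν x ≤ α ν)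
    (hT : MemLp T ∞ (volume.restrict Ω)) :
    ∫⁻ p, ENNReal.ofReal (κ p.1 p.2.1 * |planck h c k p.1 (T p.2.1) - planck h c k p.1 T₀|)
      ∂(phaseMeasure Ω) ≠ ⊤ := by
  obtain ⟨A, hA, hle⟩ := planck_le_cube hh hc hk
  obtain ⟨M, hM⟩ : ∃ M : ℝ, ∀ᵐ x ∂((volume : Measure Space).restrict Ω), ‖T x‖ ≤ M :=
    ⟨_, ae_le_eLpNormEssSup.mono fun x hx => by
      have h1 : eLpNormEssSup T (volume.restrict Ω) ≠ ⊤ := by simpa using hT.2.ne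
      simpa using (ENNReal.toReal_le_toReal (by simp) h1).2 hx⟩
  have hΩfin : volume Ω ≠ ⊤ := hΩb.measure_lt_top.ne
  -- Here integrability in `ν` comes from `α` alone, so a bound of the Planck distribution uniform
  -- in `ν` is enough.
  set K : ℝ := A * M ^ 3 + A * T₀ ^ 3 with hK
  have hFm : AEMeasurable (fun p : ℝ × Space × Direction => ENNReal.ofReal (α p.1 * K))
      (phaseMeasure Ω) :=
    (hα.aemeasurable.mul_const K).ennreal_ofReal.comp_quasiMeasurePreserving
      Measure.quasiMeasurePreserving_fst
  refine ne_top_of_le_ne_top (b := ∫⁻ p, ENNReal.ofReal (α p.1 * K) ∂(phaseMeasure Ω)) ?_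
    (lintegral_mono_ae ?_)
  · rw [lintegral_phase hFm]
    simp only
    rw [lintegral_radiationMeasure (f := fun ν => ENNReal.ofReal (α ν * K))
      (hα.aemeasurable.mul_const K).ennreal_ofReal, lintegral_const, Measure.restrict_apply_univ]
    exact ENNReal.mul_ne_top (ENNReal.mul_ne_top (hα.mul_const K).lintegral_lt_top.ne
      (measure_ne_top _ _)) hΩfin
  · filter_upwards [ae_phase_mem hΩo, (quasiMeasurePreserving_position Ω).ae hT0,
      (quasiMeasurePreserving_position Ω).ae hM] with p hp hTp hMp
    have h0 := hκ _ hp.1 _ hp.2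
    have h1 := hC _ hp.1 _ hp.2
    have h2 := planck_nonneg (c := c) hh hk hp.1 hTp
    have h3 := planck_nonneg (c := c) hh hk hp.1 hT₀.le
    have h4 := hle p.1 (T p.2.1) hp.1 hTp
    have h5 := hle p.1 T₀ hp.1 hT₀.le
    rw [Real.norm_of_nonneg hTp] at hMp
    have h6 : A * T p.2.1 ^ 3 ≤ A * M ^ 3 := by gcongr
    refine ENNReal.ofReal_le_ofReal (mul_le_mul h1 ?_ (abs_nonneg _) (h0.le.trans h1))
    rw [abs_le, hK]
    constructor <;> linarith

end Source

/-! ### The transport equation along chords -/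

section Chord

variable {h c k : ℝ} {Ω : Set Space} {κ : ℝ → Space → ℝ} {T : Space → ℝ} {T₀ : ℝ}
  {g I : ℝ → Space → Direction → ℝ}

theorem absolutelyContinuous_chord {ν : ℝ} {x : Space} {n : Direction} {a b : ℝ}
    (htr : TransportOnChord h c k Ω κ T I ν x n)
    (hab : {t : ℝ | x + t • (n : Space) ∈ Ω} = Ioo a b) {a' b' : ℝ} (ha : a < a') (hle : a' ≤ b')
    (hb : b' < b) :
    AbsolutelyContinuousOnInterval (fun t : ℝ => I ν (x + t • (n : Space)) n) a' b' := by
  have h1 : a' ∈ {t : ℝ | x + t • (n : Space) ∈ Ω} := hab ▸ ⟨ha, hle.trans_lt hb⟩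
  have h2 : b' ∈ {t : ℝ | x + t • (n : Space) ∈ Ω} := hab ▸ ⟨ha.trans_le hle, hb⟩
  exact htr.1 a' b' hle h1 h2

/-- Along a chord, the absorbed deviation from equilibrium is smaller than the emitted one by a
definite factor. -/
theorem chordTimes_gap (hΩo : IsOpen Ω) (hΩb : Bornology.IsBounded Ω)
    (hΩc : Convex ℝ Ω) (hΩ1 : HasC1Boundary Ω) (hκm : Measurable (Function.uncurry κ))
    (hκ : ∀ ν : ℝ, 0 < ν → ∀ x ∈ Ω, 0 < κ ν x)
    (hg : ∀ ν : ℝ, 0 < ν → ∀ (y : Space) (n : Direction),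
      IsIncoming Ω y n → g ν y n = planck h c k ν T₀)
    (hbd : ∀ ν : ℝ, 0 < ν → ∃ C : ℝ, ∀ x ∈ Ω, κ ν x ≤ C)
    {p : ℝ × Space × Direction} (hν : 0 < p.1) (hx : p.2.1 ∈ Ω)
    (htr : TransportOnChord h c k Ω κ T I p.1 p.2.1 p.2.2)
    (hin : IncomingOnChord Ω g I p.1 p.2.1 p.2.2) :
    ∃ δ : ℝ, 0 < δ ∧ ENNReal.ofReal (1 + δ) *
      ∫⁻ t in chordTimes transportFlow (phaseDomain Ω) p, (fun q : ℝ × Space × Direction =>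
        ENNReal.ofReal (κ q.1 q.2.1 * |I q.1 q.2.1 q.2.2 - planck h c k q.1 T₀|))
          (transportFlow t p) ≤
      ∫⁻ t in chordTimes transportFlow (phaseDomain Ω) p, (fun q : ℝ × Space × Direction =>
        ENNReal.ofReal (κ q.1 q.2.1 * |planck h c k q.1 (T q.2.1) - planck h c k q.1 T₀|))
          (transportFlow t p) := by
  obtain ⟨ν, x, n⟩ := p
  simp only at hν hx htr hin
  obtain ⟨a, b, ha, hb, hab, hinc⟩ := exists_chord hΩo hΩb hΩc hΩ1 hx n
  obtain ⟨C, hC⟩ := hbd ν hν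
  rw [chordTimes_transportFlow (by exact hν)]
  simp only [transportFlow]
  rw [hab]
  have hmem : ∀ t ∈ Ioo a b, x + t • (n : Space) ∈ Ω := fun t ht => by
    have : t ∈ {t : ℝ | x + t • (n : Space) ∈ Ω} := hab ▸ ht
    exact this
  -- Subtracting the equilibrium value, constant along the ray, preserves the form of the equation
  -- and makes the incoming value zero.
  refine chord_gap (C := C) (κ := fun t => κ ν (x + t • (n : Space)))
    (β := fun t => planck h c k ν (T (x + t • (n : Space))) - planck h c k ν T₀)
    (J := fun t => I ν (x + t • (n : Space)) n - planck h c k ν T₀) (ha.trans hb) ?_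
    (fun t ht => hκ ν hν _ (hmem t ht)) (fun t ht => hC _ (hmem t ht)) ?_ ?_ ?_
  · have hline : Measurable fun t : ℝ => x + t • (n : Space) := by fun_prop
    exact hκm.comp (measurable_const.prodMk hline)
  · intro a' b' ha' hle hb'
    exact (absolutelyContinuous_chord htr hab ha' hle hb').fun_sub
      (contDiff_const (c := planck h c k ν T₀)).contDiffOn.absolutelyContinuousOnInterval
  · filter_upwards [htr.2] with t ht htm
    exact ((ht (hmem t htm)).sub_const (planck h c k ν T₀)).congr_deriv (by ring)
  -- The entry point is reached backwards after time `-a`; the boundary limit is then moved from the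
  -- parameter `0` at that point to `a`.
  · have h1 := hin (-a) (by linarith) (by simpa using hinc)
    rw [hg ν hν _ _ (by simpa using hinc)] at h1
    have h2 : Tendsto (fun t : ℝ => t - a) (𝓝[>] a) (𝓝[>] 0) := by
      refine tendsto_nhdsWithin_iff.2 ⟨?_, ?_⟩
      · have : Continuous fun t : ℝ => t - a := by fun_prop
        simpa using (this.tendsto a).mono_left nhdsWithin_le_nhds
      · filter_upwards [self_mem_nhdsWithin] with t ht
        simpa using ht
    have h3 := (h1.comp h2).sub_const (planck h c k ν T₀)
    rw [sub_self] at h3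
    refine h3.congr fun t => ?_
    have h4 : x - -a • (n : Space) + (t - a) • (n : Space) = x + t • (n : Space) := by module
    simp only [Function.comp_apply, h4]

/-- The weak form of the transport equation on a chord. -/
theorem chordTimes_weak (hΩo : IsOpen Ω) (hΩb : Bornology.IsBounded Ω)
    (hΩc : Convex ℝ Ω) (hΩ1 : HasC1Boundary Ω)
    {φ : Space → ℝ} (hφ : ContDiff ℝ ∞ φ) (hφs : tsupport φ ⊆ Ω)
    {p : ℝ × Space × Direction} (hν : 0 < p.1) (hx : p.2.1 ∈ Ω)
    (htr : TransportOnChord h c k Ω κ T I p.1 p.2.1 p.2.2) :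
    IntegrableOn (fun t => (fun q : ℝ × Space × Direction =>
        φ q.2.1 * (κ q.1 q.2.1 * (planck h c k q.1 (T q.2.1) - I q.1 q.2.1 q.2.2)) +
          I q.1 q.2.1 q.2.2 * inner ℝ (gradient φ q.2.1) (q.2.2 : Space)) (transportFlow t p))
        (chordTimes transportFlow (phaseDomain Ω) p) ∧
      ∫ t in chordTimes transportFlow (phaseDomain Ω) p, (fun q : ℝ × Space × Direction =>
        φ q.2.1 * (κ q.1 q.2.1 * (planck h c k q.1 (T q.2.1) - I q.1 q.2.1 q.2.2)) +
          I q.1 q.2.1 q.2.2 * inner ℝ (gradient φ q.2.1) (q.2.2 : Space)) (transportFlow t p)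
        = 0 := by
  obtain ⟨ν, x, n⟩ := p
  simp only at hν hx htr
  obtain ⟨a, b, ha, hb, hab, -⟩ := exists_chord hΩo hΩb hΩc hΩ1 hx n
  rw [chordTimes_transportFlow (by exact hν)]
  simp only [transportFlow]
  rw [hab]
  have hmem : ∀ t ∈ Ioo a b, x + t • (n : Space) ∈ Ω := fun t ht => by
    have : t ∈ {t : ℝ | x + t • (n : Space) ∈ Ω} := hab ▸ ht
    exact this
  have hcont : Continuous fun t : ℝ => x + t • (n : Space) := by fun_prop
  -- Adding `0` keeps `K` nonempty when the ray misses the support of `φ`.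
  set K : Set ℝ := insert 0 {t : ℝ | x + t • (n : Space) ∈ tsupport φ} with hK
  have hKs : K ⊆ Ioo a b := by
    refine insert_subset ⟨ha, hb⟩ fun t ht => ?_
    rw [← hab]
    exact hφs ht
  have hKc : IsClosed K := by
    have h1 := (isClosed_tsupport φ).preimage hcont
    exact isClosed_singleton.union h1
  have hKne : K.Nonempty := ⟨0, mem_insert _ _⟩
  have hKbb : BddBelow K := ⟨a, fun t ht => (hKs ht).1.le⟩
  have hKba : BddAbove K := ⟨b, fun t ht => (hKs ht).2.le⟩
  obtain ⟨a', ha1, ha2⟩ := exists_between (hKs (hKc.csInf_mem hKne hKbb)).1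
  obtain ⟨b', hb1, hb2⟩ := exists_between (hKs (hKc.csSup_mem hKne hKba)).2
  have hle : a' ≤ b' := 
    ha2.le.trans (((csInf_le hKbb (mem_insert _ _)).trans (le_csSup hKba (mem_insert _ _))).trans
      hb1.le)
  have hline : ContDiff ℝ ∞ fun t : ℝ => φ (x + t • (n : Space)) := by
    refine hφ.comp ?_
    fun_prop
  have hd : ∀ t : ℝ, deriv (fun t : ℝ => φ (x + t • (n : Space))) t =
      inner ℝ (gradient φ (x + t • (n : Space))) (n : Space) := fun t =>
    (hasDerivAt_comp_line ((hφ.differentiable (by simp)).differentiableAt)).deriv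
  have h1 := integral_chord_eq_zero (a := a) (b := b) ha1 hle hb2
    (u := fun t => I ν (x + t • (n : Space)) n)
    (r := fun t => κ ν (x + t • (n : Space)) *
        (planck h c k ν (T (x + t • (n : Space))) - I ν (x + t • (n : Space)) n))
    (φ := fun t => φ (x + t • (n : Space)))
    (absolutelyContinuous_chord htr hab ha1 hle hb2)
    (by
      filter_upwards [htr.2] with t ht htm
      exact ht (hmem t htm))
    (hline.of_le (by norm_cast))
    (fun t ht => by
      by_contra hcon
      have h2 : t ∈ K := mem_insert_of_mem _ (subset_tsupport φ hcon)
      exact ht ⟨ha2.trans_le (csInf_le hKbb h2), (le_csSup hKba h2).trans_lt hb1⟩)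
  simp only [hd] at h1
  exact h1

end Chord

/-! ### Local energy balance -/

/-- If `f` and `g` have the same integral and `f` does not change sign, then the `L¹` norm of `f` is
at most that of `g`. -/
theorem lintegral_abs_le_of_integral_sub_eq_zero {Y : Type*} [MeasurableSpace Y] {m : Measure Y}
    {f g : Y → ℝ} (hf : Integrable f m) (hg : Integrable g m) (h0 : ∫ y, (f y - g y) ∂m = 0)
    (hsign : (∀ᵐ y ∂m, 0 ≤ f y) ∨ ∀ᵐ y ∂m, f y ≤ 0) :
    ∫⁻ y, ENNReal.ofReal |f y| ∂m ≤ ∫⁻ y, ENNReal.ofReal |g y| ∂m := by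
  rw [integral_sub hf hg, sub_eq_zero] at h0
  rw [← ofReal_integral_eq_lintegral_ofReal hf.abs (ae_of_all _ fun _ => abs_nonneg _),
    ← ofReal_integral_eq_lintegral_ofReal hg.abs (ae_of_all _ fun _ => abs_nonneg _)]
  refine ENNReal.ofReal_le_ofReal ?_
  have h1 : |∫ y, g y ∂m| ≤ ∫ y, |g y| ∂m := abs_integral_le_integral_abs
  rw [← h0] at h1
  refine le_trans ?_ h1
  rcases hsign with hs | hs
  · rw [integral_congr_ae (hs.mono fun y hy => abs_of_nonneg hy)]
    exact le_abs_self _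
  · rw [integral_congr_ae (hs.mono fun y hy => abs_of_nonpos hy), integral_neg]
    exact neg_le_abs _

section Balance

variable {h c k : ℝ} {Ω : Set Space} {κ : ℝ → Space → ℝ} {T : Space → ℝ} {T₀ : ℝ}
  {I : ℝ → Space → Direction → ℝ}

/-- The pairing of the flux with the gradient of a test function as a phase space integral. -/
theorem integral_flux_gradient
    (hI : Integrable (fun p : ℝ × Space × Direction => I p.1 p.2.1 p.2.2) (phaseMeasure Ω))
    {v : Space → Space} (hint : Integrable (fun p : ℝ × Space × Direction =>
      I p.1 p.2.1 p.2.2 * inner ℝ (v p.2.1) (p.2.2 : Space)) (phaseMeasure Ω)) :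
    ∫ p, I p.1 p.2.1 p.2.2 * inner ℝ (v p.2.1) (p.2.2 : Space) ∂(phaseMeasure Ω) =
      ∫ x in Ω, inner ℝ (flux I x) (v x) := by
  rw [integral_phase hint]
  refine integral_congr_ae ?_
  filter_upwards [(integrable_reorder hI).prod_right_ae] with x hx
  have hcoe : Measurable fun q : ℝ × Direction => (q.2 : Space) :=
    measurable_subtype_coe.comp measurable_snd
  have h1 : Integrable (fun q : ℝ × Direction => I q.1 x q.2 • (q.2 : Space))
      radiationMeasure := by
    refine hx.mono (hx.1.smul hcoe.aestronglyMeasurable) (ae_of_all _ fun q => ?_)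
    simp [norm_smul]
  -- Joint integrability at almost every `x` turns the iterated integral defining the flux into one
  -- over frequency and direction.
  have h2 : flux I x = ∫ q, I q.1 x q.2 • (q.2 : Space) ∂radiationMeasure := by
    rw [flux, radiationMeasure, integral_prod _ h1]
  rw [h2, real_inner_comm, ← integral_inner h1]
  refine integral_congr_ae (ae_of_all _ fun q => ?_)
  simp [inner_smul_right]

/-- Local balance of absorbed and emitted energy, from the vanishing divergence of the flux. -/
theorem ae_energy_balance (hΩo : IsOpen Ω) (hΩb : Bornology.IsBounded Ω)
    (hΩc : Convex ℝ Ω) (hΩ1 : HasC1Boundary Ω)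
    (hI : Integrable (fun p : ℝ × Space × Direction => I p.1 p.2.1 p.2.2) (phaseMeasure Ω))
    (htr : ∀ᵐ p ∂(phaseMeasure Ω), TransportOnChord h c k Ω κ T I p.1 p.2.1 p.2.2)
    (hdiv : DivergenceFree Ω (flux I))
    (hS : Integrable (fun p : ℝ × Space × Direction =>
      κ p.1 p.2.1 * (planck h c k p.1 (T p.2.1) - I p.1 p.2.1 p.2.2)) (phaseMeasure Ω)) :
    ∀ᵐ x ∂(volume.restrict Ω), ∫ q : ℝ × Direction,
      κ q.1 x * (planck h c k q.1 (T x) - I q.1 x q.2) ∂radiationMeasure = 0 := by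
  set S : ℝ × Space × Direction → ℝ := fun p =>
    κ p.1 p.2.1 * (planck h c k p.1 (T p.2.1) - I p.1 p.2.1 p.2.2) with hSdef
  set G : Space → ℝ := fun x => ∫ q : ℝ × Direction, S (q.1, x, q.2) ∂radiationMeasure with hG
  have hGi : IntegrableOn G Ω := (integrable_reorder hS).integral_prod_left
  change ∀ᵐ x ∂(volume.restrict Ω), G x = 0
  rw [ae_restrict_iff' hΩo.measurableSet]
  -- The net emission `G` is shown to vanish by testing it against smooth functions with compact
  -- support in `Ω`.
  refine hΩo.ae_eq_zero_of_integral_contDiff_smul_eq_zero hGi.locallyIntegrableOn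
    fun φ hφ hφc hφs => ?_
  have hφm : Measurable fun p : ℝ × Space × Direction => φ p.2.1 :=
    hφ.continuous.measurable.comp (measurable_fst.comp measurable_snd)
  have hgc : Continuous (gradient φ) :=
    (InnerProductSpace.toDual ℝ Space).symm.continuous.comp (hφ.continuous_fderiv (by simp))
  have hgm : Measurable fun p : ℝ × Space × Direction =>
      inner ℝ (gradient φ p.2.1) (p.2.2 : Space) :=
    (hgc.measurable.comp (measurable_fst.comp measurable_snd)).inner
      (measurable_subtype_coe.comp (measurable_snd.comp measurable_snd))
  obtain ⟨M₁, hM₁⟩ := hφc.exists_bound_of_continuous hφ.continuous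
  obtain ⟨M₂, hM₂⟩ : ∃ M : ℝ, ∀ x, ‖gradient φ x‖ ≤ M := by
    obtain ⟨M, hM⟩ := (hφc.fderiv ℝ).exists_bound_of_continuous (hφ.continuous_fderiv (by simp))
    exact ⟨M, fun x => by simpa [gradient] using hM x⟩
  have hi1 : Integrable (fun p => φ p.2.1 * S p) (phaseMeasure Ω) :=
    hS.bdd_mul hφm.aestronglyMeasurable (ae_of_all _ fun p => hM₁ p.2.1)
  have hi2 : Integrable (fun p : ℝ × Space × Direction =>
      I p.1 p.2.1 p.2.2 * inner ℝ (gradient φ p.2.1) (p.2.2 : Space)) (phaseMeasure Ω) := by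
    refine hI.mul_bdd (c := M₂) hgm.aestronglyMeasurable (ae_of_all _ fun p => ?_)
    refine (norm_inner_le_norm _ _).trans ?_
    simpa using hM₂ p.2.1
  -- The integrand is the derivative of `φ I` along the ray. It integrates to zero over each chord,
  -- since `φ` vanishes near both ends.
  have hzero : ∫ p, (φ p.2.1 * S p +
      I p.1 p.2.1 p.2.2 * inner ℝ (gradient φ p.2.1) (p.2.2 : Space)) ∂(phaseMeasure Ω) = 0 := by
    have hmem := ae_phase_mem hΩo
    have hi := hi1.add hi2
    rw [phaseMeasure_eq] at htr hmem hi ⊢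
    refine (isTransientFlow hΩo hΩb hΩc hΩ1).setIntegral_eq_zero hi ?_
    filter_upwards [htr, hmem] with p hp hpm
    exact chordTimes_weak hΩo hΩb hΩc hΩ1 hφ hφs hpm.1 hpm.2 hp
  rw [integral_add hi1 hi2, integral_flux_gradient hI hi2, hdiv φ hφ hφc hφs, add_zero,
    integral_phase hi1] at hzero
  rw [← setIntegral_eq_integral_of_forall_compl_eq_zero (s := Ω), ← hzero]
  · refine integral_congr_ae (ae_of_all _ fun x => ?_)
    simp only [hG, smul_eq_mul]
    rw [integral_const_mul]
  · intro x hx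
    rw [image_eq_zero_of_notMem_tsupport fun h => hx (hφs h), zero_smul]

end Balance

end Radiative

/-! ### Absorption against emission, and the conclusion -/

theorem theorem5p3
    (h c k : ℝ) (hh : 0 < h) (hc : 0 < c) (hk : 0 < k)
    (Ω : Set Radiative.Space) (hΩo : IsOpen Ω) (hΩb : Bornology.IsBounded Ω)
    (hΩc : Convex ℝ Ω) (hΩ1 : Radiative.HasC1Boundary Ω)
    (κ : ℝ → Radiative.Space → ℝ) (hκm : Measurable (Function.uncurry κ))
    (hκ : ∀ ν : ℝ, 0 < ν → ∀ x ∈ Ω, 0 < κ ν x)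
    (T₀ : ℝ) (hT₀ : 0 < T₀)
    (g : ℝ → Radiative.Space → Radiative.Direction → ℝ)
    (hg : ∀ ν : ℝ, 0 < ν → ∀ (y : Radiative.Space) (n : Radiative.Direction),
      Radiative.IsIncoming Ω y n → g ν y n = Radiative.planck h c k ν T₀)
    (T : Radiative.Space → ℝ) (I : ℝ → Radiative.Space → Radiative.Direction → ℝ)
    (hsol : Radiative.IsSolution h c k Ω κ g T I)
    (hT : ((∃ C : ℝ, ∀ ν : ℝ, 0 < ν → ∀ x ∈ Ω, κ ν x ≤ C) ∧
            MemLp T 4 (volume.restrict Ω)) ∨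
          ((∃ α : ℝ → ℝ, IntegrableOn α (Ioi 0) ∧
              ∀ ν : ℝ, 0 < ν → ∀ x ∈ Ω, κ ν x ≤ α ν) ∧
            MemLp T ∞ (volume.restrict Ω))) :
    ∀ᵐ x ∂(volume.restrict Ω), T x = T₀ := by
  have hT0 := hsol.temp_nonneg
  -- A bound for each separate frequency is enough on rays, because the frequency is constant along
  -- a ray and the gap need not be uniform.
  have hbd : ∀ ν : ℝ, 0 < ν → ∃ C : ℝ, ∀ x ∈ Ω, κ ν x ≤ C := by
    rcases hT with ⟨⟨C, hC⟩, -⟩ | ⟨⟨α, -, hα⟩, -⟩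
    · exact fun ν hν => ⟨C, hC ν hν⟩
    · exact fun ν hν => ⟨α ν, hα ν hν⟩
  have hTm : AEMeasurable T (volume.restrict Ω) := by
    rcases hT with ⟨-, hT⟩ | ⟨-, hT⟩ <;> exact hT.1.aemeasurable
  set bb : ℝ × Radiative.Space × Radiative.Direction → ℝ := fun p =>
    Radiative.planck h c k p.1 (T p.2.1) - Radiative.planck h c k p.1 T₀ with hbb
  set JJ : ℝ × Radiative.Space × Radiative.Direction → ℝ := fun p =>
    I p.1 p.2.1 p.2.2 - Radiative.planck h c k p.1 T₀ with hJJ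
  set kk : ℝ × Radiative.Space × Radiative.Direction → ℝ := fun p => κ p.1 p.2.1 with hkk
  have hfin : ∫⁻ p, ENNReal.ofReal (kk p * |bb p|) ∂(Radiative.phaseMeasure Ω) ≠ ⊤ := by
    rcases hT with ⟨⟨C, hC⟩, hT⟩ | ⟨⟨α, hα, hC⟩, hT⟩
    · exact Radiative.lintegral_emission_ne_top_of_memLp hh hc hk hΩo hΩb hT₀ hκ hT0 hC hT
    · exact Radiative.lintegral_emission_ne_top_of_bounded hh hc hk hΩo hΩb hT₀ hκ hT0 hα hC hT
  have hkm : Measurable kk := Radiative.measurable_absorption hκm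
  have hbm : AEMeasurable bb (Radiative.phaseMeasure Ω) :=
    (Radiative.aemeasurable_planck_phase hTm).sub
      (Radiative.measurable_planck_const h c k T₀).aemeasurable
  have hJm : AEMeasurable JJ (Radiative.phaseMeasure Ω) :=
    hsol.integrable.aemeasurable.sub (Radiative.measurable_planck_const h c k T₀).aemeasurable
  have hmem := Radiative.ae_phase_mem hΩo
  have hfm : AEMeasurable (fun p => ENNReal.ofReal (kk p * |bb p|)) (Radiative.phaseMeasure Ω) :=
    (hkm.aemeasurable.mul hbm.norm).ennreal_ofReal
  have hgm : AEMeasurable (fun p => ENNReal.ofReal (kk p * |JJ p|)) (Radiative.phaseMeasure Ω) :=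
    (hkm.aemeasurable.mul hJm.norm).ennreal_ofReal
  have hflow := Radiative.isTransientFlow hΩo hΩb hΩc hΩ1
  have hgap : ∀ᵐ p ∂(Radiative.phaseMeasure Ω), ∃ δ : ℝ, 0 < δ ∧ ENNReal.ofReal (1 + δ) *
      ∫⁻ t in Radiative.chordTimes Radiative.transportFlow (Radiative.phaseDomain Ω) p,
        (fun p => ENNReal.ofReal (kk p * |JJ p|)) (Radiative.transportFlow t p) ≤
      ∫⁻ t in Radiative.chordTimes Radiative.transportFlow (Radiative.phaseDomain Ω) p,
        (fun p => ENNReal.ofReal (kk p * |bb p|)) (Radiative.transportFlow t p) := by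
    filter_upwards [hmem, hsol.transport, hsol.incoming] with p hp htr hin
    exact Radiative.chordTimes_gap hΩo hΩb hΩc hΩ1 hκm hκ hg hbd hp.1 hp.2 htr hin
  have habs : ∀ᵐ p ∂(Radiative.phaseMeasure Ω), ∀ r : ℝ, |kk p * r| = kk p * |r| := by
    filter_upwards [hmem] with p hp r
    rw [abs_mul, abs_of_pos (hκ _ hp.1 _ hp.2)]
  -- Finite emission thus gives finite absorption. This makes `κ(B_ν(T) - I)` integrable, which the
  -- energy balance requires and which does not follow from `I ∈ L¹` when `κ` is unbounded in `ν`.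
  have hleft : ∫⁻ p, ENNReal.ofReal (kk p * |JJ p|) ∂(Radiative.phaseMeasure Ω) ≤
      ∫⁻ p, ENNReal.ofReal (kk p * |bb p|) ∂(Radiative.phaseMeasure Ω) := by
    rw [Radiative.phaseMeasure_eq] at hgap hfm hgm ⊢
    exact hflow.setLIntegral_le_of_gap hfm hgm hgap
  have hint : ∀ r : ℝ × Radiative.Space × Radiative.Direction → ℝ,
      AEMeasurable r (Radiative.phaseMeasure Ω) →
      ∫⁻ p, ENNReal.ofReal (kk p * |r p|) ∂(Radiative.phaseMeasure Ω) ≠ ⊤ →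
      Integrable (fun p => kk p * r p) (Radiative.phaseMeasure Ω) := by
    intro r hr hr'
    refine ⟨(hkm.aemeasurable.mul hr).aestronglyMeasurable, ?_⟩
    rw [hasFiniteIntegral_iff_norm]
    refine lt_of_eq_of_lt (lintegral_congr_ae ?_) hr'.lt_top
    filter_upwards [habs] with p hp
    rw [Real.norm_eq_abs, hp]
  have hbi := hint bb hbm hfin
  have hJi := hint JJ hJm (ne_top_of_le_ne_top hfin hleft)
  have hS : Integrable (fun p : ℝ × Radiative.Space × Radiative.Direction =>
      κ p.1 p.2.1 * (Radiative.planck h c k p.1 (T p.2.1) - I p.1 p.2.1 p.2.2))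
      (Radiative.phaseMeasure Ω) := by
    refine (hbi.sub hJi).congr (ae_of_all _ fun p => ?_)
    simp only [hbb, hJJ, hkk, Pi.sub_apply]
    ring
  have hbal := Radiative.ae_energy_balance hΩo hΩb hΩc hΩ1 hsol.integrable hsol.transport
    hsol.divergenceFree hS
  have hright : ∫⁻ p, ENNReal.ofReal (kk p * |bb p|) ∂(Radiative.phaseMeasure Ω) ≤
      ∫⁻ p, ENNReal.ofReal (kk p * |JJ p|) ∂(Radiative.phaseMeasure Ω) := by
    rw [Radiative.lintegral_phase hfm, Radiative.lintegral_phase hgm]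
    refine lintegral_mono_ae ?_
    filter_upwards [hbal, hT0, (Radiative.integrable_reorder hbi).prod_right_ae,
      (Radiative.integrable_reorder hJi).prod_right_ae, Radiative.ae_ae_of_ae_phase hmem,
      Radiative.ae_ae_of_ae_phase habs] with x hx hTx hbx hJx hmx hax
    have h1 := Radiative.lintegral_abs_le_of_integral_sub_eq_zero hbx hJx
      (by
        rw [← hx]
        refine integral_congr_ae (ae_of_all _ fun q => ?_)
        simp only [hbb, hJJ, hkk]
        ring)
      (by
        -- At a fixed `x` the comparison of `T x` with `T₀` decides the sign of the source for all
        -- frequencies at once.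
        rcases le_total T₀ (T x) with hle | hle
        · left
          filter_upwards [hmx] with q hq
          exact mul_nonneg (hκ _ hq.1 _ hq.2).le (sub_nonneg.2
            ((Radiative.planck_strictMonoOn hh hc hk hq.1).monotoneOn hT₀.le hTx hle))
        · right
          filter_upwards [hmx] with q hq
          exact mul_nonpos_of_nonneg_of_nonpos (hκ _ hq.1 _ hq.2).le (sub_nonpos.2
            ((Radiative.planck_strictMonoOn hh hc hk hq.1).monotoneOn hTx hT₀.le hle)))
    refine le_of_eq_of_le (lintegral_congr_ae ?_) (h1.trans_eq (lintegral_congr_ae ?_))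
    · filter_upwards [hax] with q hq
      rw [hq]
    · filter_upwards [hax] with q hq
      rw [hq]
  have hzero : ∫⁻ p, ENNReal.ofReal (kk p * |bb p|) ∂(Radiative.phaseMeasure Ω) = 0 := by
    rw [Radiative.phaseMeasure_eq] at hgap hfm hgm hfin hright ⊢
    exact hflow.setLIntegral_eq_zero_of_gap hfm hgm hgap hfin hright
  rw [lintegral_eq_zero_iff' hfm] at hzero
  have hne : NeBot (ae Radiative.radiationMeasure) := ae_neBot.2 Radiative.radiationMeasure_ne_zero
  filter_upwards [Radiative.ae_ae_of_ae_phase hzero, Radiative.ae_ae_of_ae_phase hmem, hT0]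
    with x hx hmx hTx
  -- A single frequency suffices, because the Planck distribution at any fixed positive frequency
  -- determines the temperature.
  obtain ⟨q, hq, hqm⟩ := (hx.and hmx).exists
  have hκq := hκ _ hqm.1 _ hqm.2
  have h1 : κ q.1 x * |bb (q.1, x, q.2)| = 0 :=
    le_antisymm (ENNReal.ofReal_eq_zero.1 hq) (mul_nonneg hκq.le (abs_nonneg _))
  have h2 := abs_eq_zero.1 ((mul_eq_zero.1 h1).resolve_left hκq.ne')
  exact (Radiative.planck_strictMonoOn hh hc hk hqm.1).injOn hTx hT₀.le (sub_eq_zero.1 h2)
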